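/- Let $\mathbb F_{64}$ be the field with 64 elements and let $\alpha\in\mathbb F_{64}$ satisfy $\alpha^6+\alpha+1=0$. Let $g(X)=\prod_{i=1}^{30}(X-\alpha^i)$, and let $c=(c_0,\dots,c_{31})$ and $w=(w_0,\dots,w_{31})$ be the coefficient vectors of $(X-\alpha^{32})\,g(X)$ and $X\,g(X)$; these are codewords of the shortened Reed–Solomon code of length 32 and dimension 2 generated by $g$. Put $(b_1,\dots,b_6)=(0,1,\alpha,\alpha^2,\alpha^3,\alpha^4)$. The parity-check matrix $\mathbf H\in\mathbb F_2^{384\times 2048}$ of the $(2048,1723)$ Reed–Solomon based LDPC code of IEEE 802.3an has, up to a relabelling of its rows and columns, rows indexed by $(i,\beta)\in\{1,\dots,6\}\times\mathbb F_{64}$, columns indexed by $(j,x)\in\{0,\dots,31\}\times\mathbb F_{64}$, and entry $1$ at $((i,\beta),(j,x))$ if $\beta c_j+b_i w_j=x$, and $0$ otherwise. Columns are the variable nodes and rows the check nodes; a variable node and a check node are neighbors if the corresponding entry is $1$. A set $\mathcal A$ of variable nodes is an absorption set if, for each $v\in\mathcal A$, a strict majority of the neighbors of $v$ are connected to $\mathcal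 A$ an even number of times, i.e. have an even number of neighbors in $\mathcal A$. It is an $(a,b)$ absorption set if moreover $|\mathcal A|=a$ and exactly $b$ check nodes have an odd number of neighbors in $\mathcal A$. For $v\in\mathcal A$ let $\mathrm{Deg}(v)$ be the number of neighbors of $v$ that are connected to $\mathcal A$ an even number of times; the class of $\mathcal A$ is the unordered array $[\mathrm{Deg}(v):v\in\mathcal A]$. Then: 1. For $b<8$ there is no $(8,b)$ absorption set. 2. No $(8,8)$ absorption set contains a variable node $v$ with $\mathrm{Deg}(v)=6$, and every $(8,8)$ absorption set has class $[5,5,5,5,5,5,5,5]$. 3. The minimum Hamming distance of the binary code $\ker\mathbf H$ is at least $10$, and consequently there is no $(9,0)$ absorption set. -/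

import Mathlib

open Polynomial

namespace LDPC

/-! ### Tanner graphs

A binary parity-check matrix `H` has its rows (indexed by `M`) as check nodes and its columns
(indexed by `N`) as variable nodes; `c` and `v` are joined when `H c v ≠ 0`. -/

/-- The check nodes that neighbor the variable node `v`. -/
def neighbors {M N : Type*} [Fintype M] (H : Matrix M N (ZMod 2)) (v : N) : Finset M :=
  {c | H c v ≠ 0}

/-- The number of times that the check node `c` is connected to the set `A`. -/
def connections {M N : Type*} (H : Matrix M N (ZMod 2)) (A : Finset N) (c : M) : ℕ :=
  (A.filter fun v => H c v ≠ 0).card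

/-- `Deg(v)`: the number of neighbors of `v` that are connected to `A` an even number of times. -/
def deg {M N : Type*} [Fintype M] (H : Matrix M N (ZMod 2)) (A : Finset N) (v : N) : ℕ :=
  ((neighbors H v).filter fun c => Even (connections H A c)).card

/-- An absorption set: the (strict) majority of the neighbors of each of its variable nodes are
connected to it an even number of times. -/
def IsAbsorptionSet {M N : Type*} [Fintype M] (H : Matrix M N (ZMod 2)) (A : Finset N) : Prop :=
  ∀ v ∈ A, (neighbors H v).card < 2 * deg H A v

/-- The extrinsic message degree: the number of check nodes that are connected to `A` an odd
number of times (such a check node is a neighbor of `A`). -/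
def emd {M N : Type*} [Fintype M] (H : Matrix M N (ZMod 2)) (A : Finset N) : ℕ :=
  (Finset.univ.filter fun c => Odd (connections H A c)).card

/-- `A` is an `(a, b)` absorption set. -/
def IsAbsorptionSetOf {M N : Type*} [Fintype M] (H : Matrix M N (ZMod 2)) (a b : ℕ)
    (A : Finset N) : Prop :=
  IsAbsorptionSet H A ∧ A.card = a ∧ emd H A = b

/-- The class of `A`: the unordered array of the numbers `Deg(v)`, `v ∈ A`. -/
def connectivityClass {M N : Type*} [Fintype M] (H : Matrix M N (ZMod 2)) (A : Finset N) :
    Multiset ℕ :=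
  A.val.map (deg H A)

/-- The binary linear code with parity-check matrix `H`. -/
def code {M N : Type*} [Fintype N] (H : Matrix M N (ZMod 2)) : Submodule (ZMod 2) (N → ZMod 2) :=
  LinearMap.ker H.mulVecLin

/-- The minimum distance of a code: the least Hamming distance of two distinct codewords. -/
noncomputable def minDist {N : Type*} [Fintype N] (C : Submodule (ZMod 2) (N → ZMod 2)) : ℕ :=
  sInf {d | ∃ x ∈ C, ∃ y ∈ C, x ≠ y ∧ hammingDist x y = d}

/-! ### The Reed-Solomon based (2048, 1723) code

`F` is the field with 64 elements and `α` a root of `X⁶ + X + 1`, a primitive element. The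
shortened Reed-Solomon code with two information symbols and length 32 consists of the words
whose polynomial is a multiple `(u + v X) g(X)` of the generator polynomial `g`. -/

/-- The generator polynomial `(X - α) (X - α²) ⋯ (X - α³⁰)`. -/
noncomputable def rsGen {F : Type*} [Field F] (α : F) : F[X] :=
  ∏ i ∈ Finset.Icc 1 30, (X - C (α ^ i))

/-- The codeword `(X - α³²) g(X)`, of weight 32, which spans the base one-dimensional subcode. -/
noncomputable def baseWord {F : Type*} [Field F] (α : F) (j : Fin 32) : F :=
  ((X - C (α ^ 32)) * rsGen α).coeff j

/-- The codeword `X g(X)`, whose multiples represent the cosets of the base subcode. -/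
noncomputable def cosetWord {F : Type*} [Field F] (α : F) (j : Fin 32) : F :=
  (X * rsGen α).coeff j

/-- The multipliers `0, 1, α, α², α³, α⁴` of `cosetWord` for the six cosets used. -/
def cosetMul {F : Type*} [Field F] (α : F) : Fin 6 → F :=
  ![0, 1, α, α ^ 2, α ^ 3, α ^ 4]

/-- The parity-check matrix, with 6 × 32 blocks of size 64 × 64. Row `(i, β)` is the symbol
location vector of the word `β • baseWord + cosetMul i • cosetWord`: in the `j`-th block of 64
columns it has a single one, at the column labelled by the `j`-th symbol of that word. -/
noncomputable def parityCheck {F : Type*} [Field F] [DecidableEq F] (α : F) :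
    Matrix (Fin 6 × F) (Fin 32 × F) (ZMod 2) :=
  Matrix.of fun r s =>
    if r.2 * baseWord α s.1 + cosetMul α r.1 * cosetWord α s.1 = s.2 then 1 else 0

end LDPC

/-! Dividing by `c_j` turns the column `(j, x)` into the point `(w_j / c_j, x / c_j)` of the affine
plane over `F`, and the check `(i, β)` into the line of slope `b_i` with height `β` at 0. The `c_j`
are nonzero and the ratios `w_j / c_j` distinct, so columns are distinct points, each on six lines,
and two points share at most one line.

Write e(A) for `emd`. Removing `v` gives e(A \ v) = e(A) + 2 Deg(v) - 6, and counting the edges into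
odd checks gives ∑ Deg + e(A) ≤ 6|A|, so some point has small Deg. The core is e ≥ 14 for six points
(`le_emd_of_card_eq_six`). If it failed, removing a point of least Deg three times would leave three
points with e = 12, a triangle whose sides have three different slopes. Putting the points back
would have to make at least nine lines even, but `triangle_sum` allows only eight. Translations and
homotheties preserve slopes, so there is one triangle for each triple of slopes, and
`checkTriangles_eq_true` searches the whole plane around each.

Hence e ≥ 12 for seven points. For eight points Deg ≥ (18 - e) / 2 everywhere, and the edge count
yields e ≥ 8, with equality only if every Deg is 5. The support of a codeword has e = 0. Its size is
even because the lines of one slope partition it, at least 7 because the six lines through a point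
each carry another one, and not 8. -/

namespace LDPC

open scoped symmDiff

/-! ### The finite search, on binary codes of points. -/

/-- The slope classes of the nonzero vectors of the plane, packed three bits at a time: the vector
with coordinates `t, y < 64` has index `t + 64 * y`. -/
def slopeTable : ℕ := 0x2BFFFFFFFFFFF3FFFFFFFFFF7FFFFFBFFFFFFFFFFFFFFFFFE7FFFFFFFFFFEFFF7FFFFFFF5FFFFF9FFFFFFFFFFFFFFFFF4CFFFFFFFFFFF7FFFFFFFFFF9FFFFFFFFFFFFFFFFFFFFFFFFF9FFFFFFFFFFFFFFFF3FFFFEBFFFFFFFBFF7FFFFFFFFFFFFFA3FFFFFFFFFFFFFFF7FFFFEFFFFFFFFFFF9FFFFFFFFFFFFFFE7FF3FFFF7FFFFFFFFFFFFD7BFFFFFFFFFFFFFFFFFFFF717FCFFFFFFFFFFFFFFFFFFFBFFFFFFFFFFFFFFFFFFFFFFFFFFFF9FFFFFFFFFFFFFFFF7FFFAFFFFFFFFFEFFFFF9FFFFFFFFEBF37FFFF9FFFFFFFFFFFFDFFFFFFFFFFFFFFFFFFFFFFFFFFFFE7FFFFFFBFFFFFFFFFFFF5FFF3FFFFFFF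BFFFFFFFFFFB5FFFCFFFFFFFFFFFFFFFFF3FFFFFFFFFFBFFFFFFFFFFFFFFFFFFF9F7FFFFFFF9FFFFFFFFEBFFFFFFFFDFFFFFFFFFFFFFFFAFFF3FFFFFFFFFFFFFFFFBFFFFFFFFFF3FFFFBFFFFFFFFF7F9FFE7FFDFFFFFFFFFFFFFFD7FFFFFFFFFFFFFFFFFF95FFD7FFFFCFFFFFFFFFFFFFFFFFFFFFFFFFFFFFFFFFFFFFFFFFFFFFFFF9FFFFFFFFFFFFFFFFFAFFFFFFFFBFFFF3FBFFFFFFFFEBFFFF3FCFFFFFFFFFFFF7FFF7FFFFFFFFFFFFFFFFFFFFFFFFFFFFE7FAFFFFFFFFFFFFFF5E7FFFFFFFFFFFFFFFFFFEFF5FFFFFBCFFFFFFFFFFFE7FFFFFFFFFFFFFFFFFFFFFFFFFFFFFFFFFFF9FFFFFCFFFFFFFFFEBFF7FFFF7FFFFFFFFFFFFFFFFAFFFFFF3FFBFFFFFFFFEFFFFFFFFFE7FFFFFFFFFFFFFFFFFCFFFFFF67FFFFFFFFFFF7FFD7FFFFFFFFFFFFFFFFFC7FFFD7FFFFFFFC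FFFFFFFF7FFFFFFFFFFFFFFFFFFFFFFFFFFFFFFFFFFFFFFF9FFFBFFFFFFFFFFAFFFFFFEFFFE7FFFFFFFFFBFFEBFFE7FFF3FFFFFFFFFDFFFFFFFFFFFFFFFFFFFFFFFFFFFFFFFFFFFFBE7FFFFFFFFFFFFC5FFFFFF7FFFFFFFFFFFFBFFF5FFFFFFFFFCFFFFFFCFFFFFFFFFF7FFFFFFFFFFFFFFFFFFFBFFFFFFFFFE1FFFFFFFFFFFFEBFFFFFDFFFFFFFFFFFFFFFFFFAFFFFFFFFF3FFFFFFFBFFFFFFFFCFFFF7FFFFFFFBFFFE7FFFFFFFDFFFFE7FFFFFFFFFFFD7FFFFFFFFFFFFBE7FDFFFFFD7FFFFFFFFFFCFFFFFFFFFFFFFFFFFFFFFFFFFFFFFFFFFFFFFFFFFFFFFFFF9FFFFFFFFFFFAFFFFFBFFCF7FFFFFFFFFFFFFEBFF3FFFFFFF3FFFFF7EFFFFFFFFFFFFFFFFFFFFFFFFFFFFFFFFFDEFFFFFE7FFFFFFF9FF5FFFFFFFFFFFFFFFFFEFFFFF5FDFFFFFFFFFFCF9FFFFFFFFFFFFF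FFFFFFFFFFFFFFFFFFFFFFFFFFFFF3FFF9FFFFFFFEFEBFFFF7FFFFFFFFFFFFFFFFFFFAFFFFFDFFFFFF3FFEFFFFFFFF9FFFFFFFFFFFFFFFFFF3FFFFFFF7FFFFFFFFE6FFFFFFFFD7FFFFFFFFFFFFF3F7FFFFFFD7FFFFFFFFFFEFFCFFFFFFFFFFFFFFFFFFFFFFFFFFFFFFFFFFFFFFFFFFDFFFFF9FFFFFFFFAFFFEFF9FFFFFFFFFFDFFFFFF8BFFFFFFFFFFFFF3DFFFFFFFFFFFFFFFFFFFFFFFFFFFFFFFFFFFFBFFFFFFFFFE7FF3FFFF5EFFFFFFFFFFFFFFFBFFFFFF5FFFFFFFFFFFF3FFCFFFFFEFFFFFFFFFFFFFFFFFFFFFDFFFFFFFFF9FFFFFFFFFF9FFFFFFEBFFDFFFFFFFFFFFFFFFFFFFFFAFFFFFFFFFFFFFFB3FFFFFF3FFEFFFFFFFFFDFFF9FFFFFFFFFDFFFFFFFFFFFFFE7FFFFFD7FFFFFFFFD9FFFDFFFFFFFFD7FFFFFFFFFFFFFFFFCFFFFFFFFFFFFFFFFFFFFFFFFFFFFFF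FFFFFFFFFFFFFFFFFF9FFFFFAFFBF2FFFFFFFFFFFFFFFFFFCEBFFFFFFFFFFFFD7FF3FFFFFFFFFFFFFFFFFFFFFFFFFFFEFFFFEFFFFFFFFFFFFE7E7FFFF5FFFFFFFFFFFFFFEFFFEFFFF5FFFFFFFFFE7FFFFFFFCFFFFFFFFFFFFFFFFFFFFFFFFFFFFFFFFFCFFFFFFFFFFFDFF9FFFEBF7FFFFFFFFFFFFFFFFFFFFFEAFFFFFFFFFFFFEFFFFF3E7FFFFFFFFFFFFFFFFFCFFFFFFFFF7FFFFFFFDFFFFFFFFFE7FFD7FFFFFFFFCFFF7FFFFFFFFFD7FFFFFDFFFFFFFFFFFFFCFFFFFFFFFFFFFFFFFFFFFFFFFFFFFEFFFFFFFFFFFFFFFFFF9FFAEE7FFFFFFFEFFFFFFFFE7FFFEBFFFFFFFFFFFDFFFFFFF3FFFFFFFFFFFFFFFFFFFFFFFFFFFFBFFFFFFFFFFFCFFFFFDE7F5FFFFFFFFFFFFFBFFFFFFFFF5FFFFFFFCFFFFFFFFDFFFFCFFFFFFFFFFFFFFEFFFFFFFFFFFE7FFFFFFFFFFFFFFFFF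FFF9E9FFFFFFFFFFFFFFFFFFFFFFFFAFFFFFFFFFFFBFFFFFCFFD3FFFFFFEFFFFFE7FFFFFFFFFFDFFFFFFFFFFFFFFFFFFFFFFE57FEFFE7FFFFDFFFFFFFFFFFD7FFFFFFFFFFFFFFFFFFFFFFCF000000000000000000000000000000000000000000000007

/-- The slope class of the vector of index `n`, or `7` if it has none. -/
def slopeCode (n : ℕ) : ℕ := Nat.land (Nat.shiftRight slopeTable (Nat.mul 3 n)) 7

/-- The code of the product of the element of code `t` with the multiplier of class `c`. -/
def scaleCode : ℕ → ℕ → ℕ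
  | 0, _ => 0
  | 1, t => t
  -- 67 is the binary code of `X⁶ + X + 1`, removed when doubling overflows six bits.
  | c + 2, t => let s := 2 * scaleCode (c + 1) t; s ^^^ (67 * (s / 64))

/-- The mask of the classes for which the line through the point `p` meets the triangle with
vertices `0`, `v2`, `v3` in a single vertex; `m1`, `m2`, `m3` are the masks of the classes that are
not those of a side at the respective vertex. -/
def actMask (v2 v3 m1 m2 m3 p : ℕ) : ℕ :=
  Nat.lor (Nat.land (Nat.shiftLeft 1 (slopeCode p)) m1)
    (Nat.lor (Nat.land (Nat.shiftLeft 1 (slopeCode (Nat.xor p v2))) m2)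
      (Nat.land (Nat.shiftLeft 1 (slopeCode (Nat.xor p v3))) m3))

/-- The number of binary ones of `m < 64`. -/
def popcount (m : ℕ) : ℕ :=
  Nat.land (Nat.shiftRight 0xD6CB23B238DAB238DA8DA691B238DA8DA6918DA691691448 (Nat.mul 3 m)) 7

/-- The line through `p` and `q` also passes through exactly one vertex of the triangle. -/
def opposed (act : ℕ → ℕ) (p q : ℕ) : Bool :=
  Nat.beq (Nat.land (Nat.shiftRight (act p) (slopeCode (Nat.xor p q))) 1) 1

/-- The points `p` and `q` are on a common line, and `opposed` does not hold. -/
def joined (act : ℕ → ℕ) (p q : ℕ) : Bool :=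
  cond (Nat.ble (slopeCode (Nat.xor p q)) 5) (cond (opposed act p q) false true) false

/-- No two points of the list are on too many lines to the triangle and to each other, and no three
of them are pairwise joined by lines of different classes. -/
def checkPoints (act : ℕ → ℕ) (P : List ℕ) : Bool :=
  P.all fun p => P.all fun q => Nat.beq p q ||
    (Nat.ble (popcount (act p) + popcount (act q) + cond (joined act p q) 1 0)
        (5 + cond (opposed act p q) 1 0) &&
      (!joined act p q || P.all fun r => !joined act p r || !joined act q r ||
        Nat.beq (slopeCode (p ^^^ q)) (slopeCode (p ^^^ r))))

/-- The points that lie on at least two lines through a single vertex of the triangle. -/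
def candidates (act : ℕ → ℕ) : List ℕ :=
  (List.range 4096).filter fun p => Nat.ble 1 (Nat.land (act p) (Nat.sub (act p) 1))

/-- The check for the triangle whose vertices are the origin, the point of slope class `i` with
abscissa `1`, and the point of slope class `j` with abscissa code `d`. -/
def checkTriangle (i j k d : ℕ) : Bool :=
  let act := actMask (1 + 64 * scaleCode i 1) (d + 64 * scaleCode j d)
    (63 - 2 ^ i - 2 ^ j) (63 - 2 ^ i - 2 ^ k) (63 - 2 ^ j - 2 ^ k)
  checkPoints act (candidates act)

/-- The check for all triangles with sides of slope classes `i < j < k`. -/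
def checkTriangles : Bool :=
  (List.range 6).all fun i => (List.range 6).all fun j => (List.range 6).all fun k =>
    !(Nat.ble (i + 1) j && Nat.ble (j + 1) k) || (List.range 64).all fun d =>
      !(Nat.beq (scaleCode k (d ^^^ 1)) (scaleCode j d ^^^ scaleCode i 1)) ||
        checkTriangle i j k d

/-- The equation on `d` in `checkTriangles` says that the third side has slope class `k`. It has one
solution for each triple of classes, so twenty triangles are tested, each against all 4096 points.
Tables packed into numerals make a query one shift and one mask. -/
theorem checkTriangles_eq_true : checkTriangles = true := by decide +kernel

theorem scaleCode_lt : ∀ c < 6, ∀ t < 64, scaleCode c t < 64 := by decide +kernel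

/-- Together with `slopeCode_spec` this certifies the numeral `slopeTable`. -/
theorem slopeCode_scaleCode : ∀ c < 6, ∀ t < 64, t ≠ 0 →
    slopeCode (t + 64 * scaleCode c t) = c := by decide +kernel

theorem slopeCode_spec : ∀ y < 64, ∀ t < 64, slopeCode (t + 64 * y) = 7 ∨
    slopeCode (t + 64 * y) < 6 ∧ y = scaleCode (slopeCode (t + 64 * y)) t ∧ t ≠ 0 := by
  decide +kernel

/-! ### The field with 64 elements and its binary codes. -/

section Field
variable {F : Type*} [Field F]

theorem charTwo_of_card [Fintype F] (hF : Fintype.card F = 64) : CharP F 2 := by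
  obtain ⟨p, hp⟩ := CharP.exists F
  have : Fact p.Prime := ⟨CharP.char_is_prime F p⟩
  obtain ⟨n, hpr, hn⟩ := FiniteField.card F p
  have : p ∣ 2 ^ 6 := by
    rw [show 2 ^ 6 = p ^ (n : ℕ) by rw [← hn, hF]; rfl]
    exact dvd_pow_self p n.pos.ne'
  have h2 := (Nat.prime_dvd_prime_iff_eq hpr Nat.prime_two).1 (hpr.dvd_of_dvd_pow this)
  exact h2 ▸ hp

/-- Every proper divisor of 63 divides 9 or 21, so only `α ^ 9 = 1` and `α ^ 21 = 1` have to be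
excluded. The multiples of `h2` reduce coefficients modulo 2. -/
theorem orderOf_root [Fintype F] (hF : Fintype.card F = 64) {α : F}
    (hα : α ^ 6 + α + 1 = 0) : orderOf α = 63 := by
  have := charTwo_of_card hF
  have h2 : (2 : F) = 0 := CharTwo.two_eq_zero
  have h0 : α ≠ 0 := by rintro rfl; simp at hα
  have h63 : α ^ 63 = 1 := by rw [← FiniteField.pow_card_sub_one_eq_one α h0, hF]
  have e9 : α ^ 9 = α ^ 4 + α ^ 3 := by linear_combination α ^ 3 * hα - (α ^ 4 + α ^ 3) * h2
  have e12 : α ^ 12 = α ^ 2 + 1 := by linear_combination (α ^ 6 - α - 1) * hα + α * h2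
  have h9 : α ^ 9 ≠ 1 := by
    intro h
    have h' : α ^ 4 + α ^ 3 + 1 = 0 := by linear_combination h - e9 + h2
    -- A Bézout identity modulo 2: `X⁴ + X³ + 1` is coprime to `X⁶ + X + 1`.
    refine one_ne_zero (α := F) ?_
    linear_combination α * hα + (α ^ 3 + α ^ 2 + α + 1) * h' -
      (α ^ 7 + α ^ 6 + α ^ 5 + α ^ 4 + α ^ 3 + α ^ 2 + α) * h2
  have h21 : α ^ 21 ≠ 1 := by
    intro h
    rw [show α ^ 21 = α ^ 9 * α ^ 12 by ring, e9, e12] at h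
    have h' : α ^ 4 + α ^ 3 + α ^ 2 + 1 = 0 := by
      refine (mul_eq_zero.1 (?_ : α * (α ^ 4 + α ^ 3 + α ^ 2 + 1) = 0)).resolve_left h0
      linear_combination h - hα + (α + 1) * h2
    refine one_ne_zero (α := F) ?_
    linear_combination α ^ 3 * hα + (α ^ 5 + α ^ 4 + α ^ 2 + 1) * h' -
      (α ^ 9 + α ^ 8 + α ^ 7 + α ^ 6 + α ^ 5 + 2 * α ^ 4 + α ^ 3 + α ^ 2) * h2
  have hd : orderOf α ∣ 63 := orderOf_dvd_of_pow_eq_one h63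
  have hmem : orderOf α ∈ Nat.divisors 63 := Nat.mem_divisors.2 ⟨hd, by norm_num⟩
  have hdiv : Nat.divisors 63 = {1, 3, 7, 9, 21, 63} := by decide +kernel
  rw [hdiv] at hmem
  have k9 : ¬ orderOf α ∣ 9 := fun h => h9 (orderOf_dvd_iff_pow_eq_one.1 h)
  have k21 : ¬ orderOf α ∣ 21 := fun h => h21 (orderOf_dvd_iff_pow_eq_one.1 h)
  simp only [Finset.mem_insert, Finset.mem_singleton] at hmem
  rcases hmem with h | h | h | h | h | h <;> rw [h] at k9 k21 <;> first | exact h | (exfalso; revert k9 k21; decide)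

/-- The element of the field with binary code `n < 64`. -/
def decode (α : F) (n : ℕ) : F := ∑ k ∈ Finset.range 6, if n.testBit k then α ^ k else 0

variable [CharP F 2]

theorem decode_xor (α : F) (m n : ℕ) : decode α (m ^^^ n) = decode α m + decode α n := by
  rw [decode, decode, decode, ← Finset.sum_add_distrib]
  refine Finset.sum_congr rfl fun k _ => ?_
  rw [Nat.testBit_xor]
  cases m.testBit k <;> cases n.testBit k <;> simp [CharTwo.add_self_eq_zero]

theorem testBit_scaleCode_two : ∀ n < 64, (scaleCode 2 n).testBit 0 = n.testBit 5 ∧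
    (scaleCode 2 n).testBit 1 = (n.testBit 0 ^^ n.testBit 5) ∧
    (scaleCode 2 n).testBit 2 = n.testBit 1 ∧ (scaleCode 2 n).testBit 3 = n.testBit 2 ∧
    (scaleCode 2 n).testBit 4 = n.testBit 3 ∧ (scaleCode 2 n).testBit 5 = n.testBit 4 := by
  decide +kernel

theorem decode_scaleCode_two {α : F} (hα : α ^ 6 + α + 1 = 0) {n : ℕ} (hn : n < 64) :
    decode α (scaleCode 2 n) = α * decode α n := by
  have h2 : (2 : F) = 0 := CharTwo.two_eq_zero
  obtain ⟨h0, h1, h2', h3, h4, h5⟩ := testBit_scaleCode_two n hn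
  have hx : (if (n.testBit 0 ^^ n.testBit 5) = true then α ^ 1 else 0) =
      (if n.testBit 0 then α ^ 1 else 0) + if n.testBit 5 then α ^ 1 else 0 := by
    cases n.testBit 0 <;> cases n.testBit 5 <;> simp [CharTwo.add_self_eq_zero]
  simp only [decode, Finset.sum_range_succ, Finset.sum_range_zero, h0, h1, h2', h3, h4, h5, hx]
  have key : ∀ (b : Bool) (x : F), (if b = true then x else 0) = (if b = true then 1 else 0) * x := by
    intro b x; cases b <;> simp
  simp only [fun b (k : ℕ) => key b (α ^ k)]
  generalize (if n.testBit 5 = true then (1 : F) else 0) = β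
  linear_combination β * hα - β * α ^ 6 * h2

theorem decode_scaleCode {α : F} (hα : α ^ 6 + α + 1 = 0) (c : Fin 6) {n : ℕ} (hn : n < 64) :
    decode α (scaleCode c n) = cosetMul α c * decode α n := by
  have h1 : decode α (scaleCode 1 n) = decode α n := rfl
  have hs : ∀ c, c + 2 < 6 →
      decode α (scaleCode (c + 2) n) = α * decode α (scaleCode (c + 1) n) := fun c hc =>
    decode_scaleCode_two hα (scaleCode_lt (c + 1) (by lia) n hn)
  have e2 := hs 0 (by lia)
  have e3 := hs 1 (by lia)
  have e4 := hs 2 (by lia)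
  have e5 := hs 3 (by lia)
  norm_num at e2 e3 e4 e5
  fin_cases c <;> simp [cosetMul, e2, e3, e4, e5, h1]
  · simp [scaleCode, decode]
  all_goals ring

variable [Fintype F]

/-- Values of codes are closed under multiplication by `α`, which generates the unit group. -/
theorem decode_surjective (hF : Fintype.card F = 64) {α : F} (hα : α ^ 6 + α + 1 = 0) (x : F) :
    ∃ n < 64, decode α n = x := by
  have h0 : α ≠ 0 := by rintro rfl; simp at hα
  have hpow : ∀ k : ℕ, ∃ n < 64, decode α n = α ^ k := by
    intro k
    induction k with
    | zero => exact ⟨1, by norm_num, by simp [decode, Finset.sum_range_succ, Nat.testBit]⟩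
    | succ k ih =>
      obtain ⟨n, hn, h⟩ := ih
      exact ⟨_, scaleCode_lt 2 (by norm_num) n hn, by rw [decode_scaleCode_two hα hn, h, pow_succ']⟩
  by_cases hx : x = 0
  · exact ⟨0, by norm_num, by simp [decode, hx]⟩
  have hord : orderOf (Units.mk0 α h0) = Nat.card Fˣ := by
    classical
    rw [← orderOf_units, Nat.card_eq_fintype_card, Fintype.card_units, hF]
    exact orderOf_root hF hα
  have htop : Subgroup.zpowers (Units.mk0 α h0) = ⊤ :=
    Subgroup.eq_top_of_card_eq _ (by rw [Nat.card_zpowers, hord])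
  obtain ⟨k, hk⟩ := (Submonoid.mem_powers_iff _ _).1
    (mem_powers_iff_mem_zpowers.2 (htop ▸ Subgroup.mem_top (Units.mk0 x hx)))
  obtain ⟨n, hn, h⟩ := hpow k
  refine ⟨n, hn, ?_⟩
  rw [h]
  simpa using congrArg Units.val hk

theorem decode_injective (hF : Fintype.card F = 64) {α : F} (hα : α ^ 6 + α + 1 = 0) {m n : ℕ}
    (hm : m < 64) (hn : n < 64) (h : decode α m = decode α n) : m = n := by
  have hs : Function.Surjective fun k : Fin 64 => decode α k := fun x => by
    obtain ⟨n, hn, h⟩ := decode_surjective hF hα x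
    exact ⟨⟨n, hn⟩, h⟩
  have hb := (Fintype.bijective_iff_surjective_and_card _).2 ⟨hs, by simp [hF]⟩
  exact congrArg Fin.val (@hb.1 ⟨m, hm⟩ ⟨n, hn⟩ h)

end Field
-- Lines of six slopes and normalised coordinates.
/-- The classes of lines in which `x` and `y` lie on the same line. -/
def common {V F : Type*} [DecidableEq F] (l : Fin 6 → V → F) (x y : V) : Finset (Fin 6) :=
  {c | l c x = l c y}

theorem mem_common {V F : Type*} [DecidableEq F] {l : Fin 6 → V → F} {x y : V} {c : Fin 6} :
    c ∈ common l x y ↔ l c x = l c y := by simp [common]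

theorem common_comm {V F : Type*} [DecidableEq F] (l : Fin 6 → V → F) (x y : V) :
    common l x y = common l y x := by ext; simp [mem_common, eq_comm]

/-- The line of slope `cosetMul α c` through the point `x` is identified by its height at `0`. -/
def height {F : Type*} [Field F] (α : F) (c : Fin 6) (x : F × F) : F :=
  x.2 + cosetMul α c * x.1

theorem add_mul_xor {m n m' n' : ℕ} (hm : m < 64) (hm' : m' < 64) :
    (m + 64 * n) ^^^ (m' + 64 * n') = (m ^^^ m') + 64 * (n ^^^ n') := by
  have hx : m ^^^ m' < 64 := Nat.xor_lt_two_pow (n := 6) hm hm'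
  rw [← Nat.mod_add_div ((m + 64 * n) ^^^ (m' + 64 * n')) 64]
  have h1 := Nat.xor_mod_two_pow (a := m + 64 * n) (b := m' + 64 * n') (n := 6)
  have h2 := Nat.xor_div_two_pow (a := m + 64 * n) (b := m' + 64 * n') (n := 6)
  norm_num at h1 h2
  rw [h1, h2]
  rw [Nat.mod_eq_of_lt hm, Nat.mod_eq_of_lt hm',
    show (m + 64 * n) / 64 = n by lia, show (m' + 64 * n') / 64 = n' by lia]

section
variable {F : Type*} [Field F] [Fintype F]

theorem exists_encode (hF : Fintype.card F = 64) {α : F} (hα : α ^ 6 + α + 1 = 0) :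
    ∃ f : F → ℕ, (∀ x, f x < 64) ∧ Function.Injective f ∧ f 1 = 1 ∧
      (∀ x y, f (x + y) = f x ^^^ f y) ∧
      ∀ (c : Fin 6) x, f (cosetMul α c * x) = scaleCode c (f x) := by
  have := charTwo_of_card hF
  choose f hlt hf using decode_surjective hF hα
  have huniq : ∀ n < 64, ∀ x, decode α n = x → f x = n := fun n hn x h =>
    decode_injective hF hα (hlt x) hn ((hf x).trans h.symm)
  refine ⟨f, hlt, fun x y h => by rw [← hf x, h, hf y], huniq 1 (by norm_num) 1 ?_,
    fun x y => huniq _ (Nat.xor_lt_two_pow (n := 6) (hlt x) (hlt y)) _ ?_,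
    fun c x => huniq _ (scaleCode_lt c c.2 _ (hlt x)) _ ?_⟩
  · simp [decode, Finset.sum_range_succ, Nat.testBit]
  · rw [decode_xor, hf, hf]
  · rw [decode_scaleCode hα c (hlt x), hf]

variable [DecidableEq F]

/-- Coordinates of the plane over the field, as numbers below `4096`, in which two given points on a
common line are the origin and a point with abscissa `1`. -/
theorem exists_planeCode (hF : Fintype.card F = 64) {α : F} (hα : α ^ 6 + α + 1 = 0)
    {u v : F × F} (huv : u ≠ v) {i : Fin 6} (hi : i ∈ common (height α) u v) :
    ∃ k : F × F → ℕ, (∀ x, k x < 4096) ∧ Function.Injective k ∧ k u = 0 ∧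
      k v = 1 + 64 * scaleCode i 1 ∧
      ∀ x y, x ≠ y → ∀ c : Fin 6, c ∈ common (height α) x y ↔ slopeCode (k x ^^^ k y) = c := by
  have := charTwo_of_card hF
  obtain ⟨f, hlt, hinj, h1, hadd, hmul⟩ := exists_encode hF hα
  have h0 : f 0 = 0 := by
    have := hadd 1 1
    rwa [CharTwo.add_self_eq_zero, Nat.xor_self] at this
  have hcom : ∀ (x y : F × F) (c : Fin 6), c ∈ common (height α) x y ↔
      x.2 + y.2 = cosetMul α c * (x.1 + y.1) := by
    intro x y c
    rw [mem_common, height, height, ← sub_eq_zero, ← sub_eq_zero (a := x.2 + y.2)]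
    simp only [CharTwo.sub_eq_add]
    ring_nf
  have hfst : ∀ (x y : F × F) (c : Fin 6), x ≠ y → c ∈ common (height α) x y → x.1 + y.1 ≠ 0 := by
    intro x y c hne hc h
    have h2 := (hcom x y c).1 hc
    rw [h, mul_zero] at h2
    exact hne (Prod.ext (CharTwo.add_eq_zero.1 h) (CharTwo.add_eq_zero.1 h2))
  have hs0 := hfst u v i huv hi
  set s := (u.1 + v.1)⁻¹ with hs
  have hsne : s ≠ 0 := inv_ne_zero hs0
  -- Translate `u` to the origin and scale the abscissa of `v` to 1; both operations preserve
  -- slopes.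
  refine ⟨fun x => f (s * (u.1 + x.1)) + 64 * f (s * (u.2 + x.2)), fun x => ?_, fun x y h => ?_, ?_,
    ?_, fun x y hxy c => ?_⟩
  · have := hlt (s * (u.1 + x.1)); have := hlt (s * (u.2 + x.2)); lia
  · have a1 := hlt (s * (u.1 + x.1))
    have a2 := hlt (s * (u.1 + y.1))
    simp only at h
    have e1 : f (s * (u.1 + x.1)) = f (s * (u.1 + y.1)) := by lia
    have e2 : f (s * (u.2 + x.2)) = f (s * (u.2 + y.2)) := by lia
    exact Prod.ext (add_left_cancel (mul_left_cancel₀ hsne (hinj e1)))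
      (add_left_cancel (mul_left_cancel₀ hsne (hinj e2)))
  · simp [CharTwo.add_self_eq_zero, h0]
  · have e : s * (u.2 + v.2) = cosetMul α i * 1 := by
      rw [(hcom u v i).1 hi, mul_left_comm, inv_mul_cancel₀ hs0]
    show f (s * (u.1 + v.1)) + 64 * f (s * (u.2 + v.2)) = _
    rw [e, hmul, h1, inv_mul_cancel₀ hs0, h1]
  · have hsum : ∀ a b w : F, f (s * (w + a)) ^^^ f (s * (w + b)) = f (s * (a + b)) := by
      intro a b w
      rw [← hadd]
      congr 1
      linear_combination s * w * CharTwo.two_eq_zero (R := F)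
    simp only
    rw [add_mul_xor (hlt _) (hlt _), hsum, hsum, hcom]
    constructor
    · intro h
      rw [h, mul_left_comm, hmul]
      refine slopeCode_scaleCode c c.2 _ (hlt _) fun h' => ?_
      have := hinj (h'.trans h0.symm)
      exact hfst x y c hxy ((hcom x y c).2 h) ((mul_eq_zero.1 this).resolve_left hsne)
    · intro h
      rcases slopeCode_spec _ (hlt (s * (x.2 + y.2))) _ (hlt (s * (x.1 + y.1))) with h7 | ⟨-, h', -⟩
      · have := c.2; lia
      · rw [h, ← hmul] at h'
        refine mul_left_cancel₀ hsne ((hinj h').trans ?_)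
        ring

end

/-! ### From the finite search to triangles in the plane. -/

theorem popcount_eq_card : ∀ m < 64,
    popcount m = (Finset.univ.filter fun c : Fin 6 => m.testBit c = true).card := by
  decide +kernel

/-- Clearing the lowest binary one leaves something when there are two; `candidates` uses this test.
-/
theorem one_le_land_sub_one : ∀ m < 64, 2 ≤ popcount m → 1 ≤ Nat.land m (Nat.sub m 1) := by
  decide +kernel

theorem testBit_mask : ∀ i j c : Fin 6, i < j →
    (63 - 2 ^ (i : ℕ) - 2 ^ (j : ℕ)).testBit c = decide (c ≠ i ∧ c ≠ j) := by decide +kernel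

theorem testBit_one_shiftLeft_land (s m c : ℕ) :
    (Nat.land (Nat.shiftLeft 1 s) m).testBit c = (decide (s = c) && m.testBit c) := by
  show ((1 <<< s) &&& m).testBit c = _
  rw [Nat.testBit_and, Nat.one_shiftLeft, Nat.testBit_two_pow]

theorem testBit_actMask (v2 v3 m1 m2 m3 p c : ℕ) :
    (actMask v2 v3 m1 m2 m3 p).testBit c = (decide (slopeCode p = c) && m1.testBit c ||
      (decide (slopeCode (p ^^^ v2) = c) && m2.testBit c ||
        decide (slopeCode (p ^^^ v3) = c) && m3.testBit c)) := by
  rw [← testBit_one_shiftLeft_land, ← testBit_one_shiftLeft_land, ← testBit_one_shiftLeft_land,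
    ← Nat.testBit_or, ← Nat.testBit_or]
  rfl

theorem actMask_lt {v2 v3 m1 m2 m3 : ℕ} (h1 : m1 < 64) (h2 : m2 < 64) (h3 : m3 < 64) (p : ℕ) :
    actMask v2 v3 m1 m2 m3 p < 64 :=
  Nat.or_lt_two_pow (n := 6) (Nat.and_lt_two_pow (n := 6) _ h1)
    (Nat.or_lt_two_pow (n := 6) (Nat.and_lt_two_pow (n := 6) _ h2) (Nat.and_lt_two_pow (n := 6) _ h3))

theorem opposed_eq_testBit (act : ℕ → ℕ) (p q : ℕ) :
    opposed act p q = (act p).testBit (slopeCode (p ^^^ q)) := by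
  show Nat.beq ((act p) >>> (slopeCode (p ^^^ q)) &&& 1) 1 = _
  rw [Nat.testBit_eq_decide_div_mod_eq, Nat.and_one_is_mod, Nat.shiftRight_eq_div_pow]
  rw [Bool.eq_iff_iff]
  simp

theorem joined_eq_true_iff (act : ℕ → ℕ) (p q : ℕ) : joined act p q = true ↔
    slopeCode (p ^^^ q) < 6 ∧ (act p).testBit (slopeCode (p ^^^ q)) = false := by
  rw [← opposed_eq_testBit]
  show cond (Nat.ble (slopeCode (p ^^^ q)) 5) (cond (opposed act p q) false true) false = true ↔ _
  have hb : (Nat.ble (slopeCode (p ^^^ q)) 5 = true) = (slopeCode (p ^^^ q) ≤ 5) := Nat.ble_eq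
  cases opposed act p q <;> cases h : Nat.ble (slopeCode (p ^^^ q)) 5 <;>
    simp [h] at hb ⊢ <;> lia

theorem mem_candidates {act : ℕ → ℕ} {p : ℕ} (hp : p < 4096) (ha : act p < 64)
    (h : 2 ≤ popcount (act p)) : p ∈ candidates act :=
  List.mem_filter.2 ⟨List.mem_range.2 hp, Nat.ble_eq_true_of_le (one_le_land_sub_one _ ha h)⟩

theorem checkPoints_pair {act : ℕ → ℕ} {P : List ℕ} (h : checkPoints act P = true) {p q : ℕ}
    (hp : p ∈ P) (hq : q ∈ P) (hpq : p ≠ q) :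
    popcount (act p) + popcount (act q) + cond (joined act p q) 1 0 ≤
      5 + cond (opposed act p q) 1 0 := by
  have := List.all_eq_true.1 (List.all_eq_true.1 h p hp) q hq
  simp only [Bool.or_eq_true, Bool.and_eq_true] at this
  rcases this with h | h
  · exact absurd (Nat.eq_of_beq_eq_true h) hpq
  · exact Nat.le_of_ble_eq_true h.1

theorem checkPoints_triple {act : ℕ → ℕ} {P : List ℕ} (h : checkPoints act P = true) {p q r : ℕ}
    (hp : p ∈ P) (hq : q ∈ P) (hr : r ∈ P) (hpq : p ≠ q) (jpq : joined act p q = true)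
    (jpr : joined act p r = true) (jqr : joined act q r = true) :
    slopeCode (p ^^^ q) = slopeCode (p ^^^ r) := by
  have := List.all_eq_true.1 (List.all_eq_true.1 h p hp) q hq
  simp only [Bool.or_eq_true, Bool.and_eq_true] at this
  rcases this with h | ⟨-, h⟩
  · exact absurd (Nat.eq_of_beq_eq_true h) hpq
  rw [jpq] at h
  have := List.all_eq_true.1 (h.resolve_left (by simp)) r hr
  rw [jpr, jqr] at this
  simpa using this

theorem checkTriangle_eq_true {i j k : Fin 6} (hij : i < j) (hjk : j < k) {d : ℕ} (hd : d < 64)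
    (h : scaleCode k (d ^^^ 1) = scaleCode j d ^^^ scaleCode i 1) :
    checkTriangle i j k d = true := by
  have h0 := checkTriangles_eq_true
  have h1 := List.all_eq_true.1 h0 i (List.mem_range.2 i.2)
  have h2 := List.all_eq_true.1 h1 j (List.mem_range.2 j.2)
  have h3 := List.all_eq_true.1 h2 k (List.mem_range.2 k.2)
  have e1 : Nat.ble (i + 1) j = true := Nat.ble_eq_true_of_le hij
  have e2 : Nat.ble (j + 1) k = true := Nat.ble_eq_true_of_le hjk
  rw [e1, e2] at h3
  rw [Bool.or_eq_true] at h3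
  have h4 := List.all_eq_true.1 (h3.resolve_left (by simp)) d (List.mem_range.2 hd)
  have e3 : Nat.beq (scaleCode k (d ^^^ 1)) (scaleCode j d ^^^ scaleCode i 1) = true := by
    rw [h]; exact Nat.beq_refl _
  rw [e3] at h4
  simpa using h4

theorem card_symmDiff_singleton_of_mem {ι : Type*} [DecidableEq ι] {s : Finset ι} {a : ι}
    (h : a ∈ s) : (s ∆ {a}).card + 1 = s.card := by
  have : s ∆ {a} = s.erase a := by
    ext b; by_cases hb : b = a <;> simp [Finset.mem_symmDiff, hb, h]
  rw [this, Finset.card_erase_add_one h]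

theorem card_symmDiff_singleton_of_notMem {ι : Type*} [DecidableEq ι] {s : Finset ι} {a : ι}
    (h : a ∉ s) : (s ∆ {a}).card = s.card + 1 := by
  have : s ∆ {a} = insert a s := by
    ext b; by_cases hb : b = a <;> simp [Finset.mem_symmDiff, hb, h]
  rw [this, Finset.card_insert_of_notMem h]

section
variable {F : Type*} [Field F] [Fintype F] [DecidableEq F]

theorem common_subsingleton (hF : Fintype.card F = 64) {α : F} (hα : α ^ 6 + α + 1 = 0)
    {x y : F × F} (hxy : x ≠ y) {c d : Fin 6} (hc : c ∈ common (height α) x y)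
    (hd : d ∈ common (height α) x y) : c = d := by
  obtain ⟨k, -, -, -, -, hk⟩ := exists_planeCode hF hα hxy hc
  exact Fin.ext (((hk x y hxy c).1 hc).symm.trans ((hk x y hxy d).1 hd))

theorem common_cases (hF : Fintype.card F = 64) {α : F} (hα : α ^ 6 + α + 1 = 0)
    (x y : F × F) (hxy : x ≠ y) :
    common (height α) x y = ∅ ∨ ∃ c, common (height α) x y = {c} := by
  rcases Finset.eq_empty_or_nonempty (common (height α) x y) with h | ⟨c, hc⟩
  · exact Or.inl h
  · exact Or.inr ⟨c, Finset.eq_singleton_iff_unique_mem.2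
      ⟨hc, fun d hd => common_subsingleton hF hα hxy hd hc⟩⟩

/-- `A`, `B`, `C` say that the line of a given class through a point contains the respective vertex,
and `I`, `J`, `K` that the class is that of a side. For the class of a side its two endpoints cancel
in the symmetric difference; for any other class at most one vertex is on the line. -/
theorem mask_iff {A B C I J K : Prop} (h1 : A → B → I) (h2 : A → C → J) (h3 : B → C → K)
    (g1 : I → (A ↔ B)) (g2 : J → (A ↔ C)) (g3 : K → (B ↔ C)) (n1 : I → ¬J) (n2 : I → ¬K)
    (n3 : J → ¬K) :
    A ∧ ¬I ∧ ¬J ∨ B ∧ ¬I ∧ ¬K ∨ C ∧ ¬J ∧ ¬K ↔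
      (A ∧ ¬B ∨ B ∧ ¬A) ∧ ¬C ∨ C ∧ ¬(A ∧ ¬B ∨ B ∧ ¬A) := by
  by_cases A <;> by_cases B <;> by_cases C <;> simp_all

/-- `D x` collects the classes whose line through `x` contains an odd number of vertices. On the
side of the codes, `joined` means that the line `pq` adds a class to `D q`, and `opposed` that it
removes one. -/
theorem triangle_check (hF : Fintype.card F = 64) {α : F} (hα : α ^ 6 + α + 1 = 0)
    {u v w : F × F} (huv : u ≠ v) (huw : u ≠ w) (hvw : v ≠ w) {i j k : Fin 6} (hij : i < j)
    (hjk : j < k) (hi : i ∈ common (height α) u v) (hj : j ∈ common (height α) u w)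
    (hk : k ∈ common (height α) v w) :
    let S := common (height α)
    let D := fun x => S u x ∆ S v x ∆ S w x
    let T : Finset (F × F) := {u, v, w}
    (∀ p q, p ∉ T → q ∉ T → p ≠ q → 2 ≤ (D p).card → 2 ≤ (D q).card →
      (D p).card + (D q ∆ S p q).card ≤ 5) ∧
    ∀ p q r, p ∉ T → q ∉ T → r ∉ T → p ≠ q → p ≠ r → q ≠ r →
      2 ≤ (D p).card → 2 ≤ (D q).card → 2 ≤ (D r).card →
      ∀ a ∈ S p q, a ∉ D p → ∀ b ∈ S p r, b ∉ D p → ∀ c ∈ S q r, c ∉ D q → a = b := by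
  intro S D T
  obtain ⟨f, hlt, hinj, hu, hv, hf⟩ := exists_planeCode hF hα huv hi
  have huniq : ∀ {x y}, x ≠ y → ∀ {c d}, c ∈ S x y → d ∈ S x y → c = d := fun h _ _ =>
    common_subsingleton hF hα h
  have hik := hij.trans hjk
  have hcases : ∀ x y, x ≠ y → S x y = ∅ ∨ ∃ c, S x y = {c} := common_cases hF hα
  obtain ⟨d, hd, hw⟩ : ∃ d < 64, f w = d + 64 * scaleCode j d := by
    have hs := (hf w u huw.symm j).1 (by rwa [common_comm])
    rw [hu, Nat.xor_zero] at hs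
    refine ⟨f w % 64, Nat.mod_lt _ (by norm_num), ?_⟩
    have h2 := slopeCode_spec (f w / 64) (by have := hlt w; lia) (f w % 64)
      (Nat.mod_lt _ (by norm_num))
    rw [show f w % 64 + 64 * (f w / 64) = f w by lia, hs] at h2
    have := j.2
    rcases h2 with h2 | ⟨-, h2, -⟩
    · lia
    · lia
  have hcheck : checkTriangle i j k d = true := by
    refine checkTriangle_eq_true hij hjk hd ?_
    have hs := (hf w v hvw.symm k).1 (by rwa [common_comm])
    rw [hw, hv, add_mul_xor hd (by norm_num)] at hs
    have h2 := slopeCode_spec (scaleCode j d ^^^ scaleCode i 1)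
      (Nat.xor_lt_two_pow (n := 6) (scaleCode_lt j j.2 d hd) (scaleCode_lt i i.2 1 (by norm_num)))
      (d ^^^ 1) (Nat.xor_lt_two_pow (n := 6) hd (by norm_num))
    rw [hs] at h2
    have := k.2
    rcases h2 with h2 | ⟨-, h2, -⟩
    · lia
    · exact h2.symm
  set act := actMask (1 + 64 * scaleCode i 1) (d + 64 * scaleCode j d)
    (63 - 2 ^ (i : ℕ) - 2 ^ (j : ℕ)) (63 - 2 ^ (i : ℕ) - 2 ^ (k : ℕ))
    (63 - 2 ^ (j : ℕ) - 2 ^ (k : ℕ)) with hact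
  have hc : checkPoints act (candidates act) = true := hcheck
  have hactlt : ∀ p, act p < 64 := actMask_lt (by lia) (by lia) (by lia)
  have hD : ∀ x ∉ T, ∀ c : Fin 6, (act (f x)).testBit c = true ↔ c ∈ D x := by
    intro x hx c
    simp only [T, Finset.mem_insert, Finset.mem_singleton, not_or] at hx
    obtain ⟨hxu, hxv, hxw⟩ := hx
    have hcu := hf x u hxu c
    have hcv := hf x v hxv c
    have hcw := hf x w hxw c
    rw [hu, Nat.xor_zero, common_comm] at hcu
    rw [hv, common_comm] at hcv
    rw [hw, common_comm] at hcw
    rw [hact, testBit_actMask, testBit_mask i j c hij, testBit_mask i k c hik,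
      testBit_mask j k c hjk]
    simp only [Bool.or_eq_true, Bool.and_eq_true, decide_eq_true_eq, ← hcu, ← hcv, ← hcw, D,
      Finset.mem_symmDiff]
    have h1 : c ∈ S u x → c ∈ S v x → c = i := fun a b =>
      huniq huv (mem_common.2 ((mem_common.1 a).trans (mem_common.1 b).symm)) hi
    have h2 : c ∈ S u x → c ∈ S w x → c = j := fun a b =>
      huniq huw (mem_common.2 ((mem_common.1 a).trans (mem_common.1 b).symm)) hj
    have h3 : c ∈ S v x → c ∈ S w x → c = k := fun a b =>
      huniq hvw (mem_common.2 ((mem_common.1 a).trans (mem_common.1 b).symm)) hk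
    have g1 : c = i → (c ∈ S u x ↔ c ∈ S v x) := fun h => by
      subst h; rw [mem_common, mem_common, mem_common.1 hi]
    have g2 : c = j → (c ∈ S u x ↔ c ∈ S w x) := fun h => by
      subst h; rw [mem_common, mem_common, mem_common.1 hj]
    have g3 : c = k → (c ∈ S v x ↔ c ∈ S w x) := fun h => by
      subst h; rw [mem_common, mem_common, mem_common.1 hk]
    have n1 : c = i → c ≠ j := fun h h' => hij.ne (h.symm.trans h')
    have n2 : c = i → c ≠ k := fun h h' => hik.ne (h.symm.trans h')
    have n3 : c = j → c ≠ k := fun h h' => hjk.ne (h.symm.trans h')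
    exact mask_iff h1 h2 h3 g1 g2 g3 n1 n2 n3
  have hpop : ∀ x ∉ T, popcount (act (f x)) = (D x).card := by
    intro x hx
    rw [popcount_eq_card _ (hactlt _)]
    refine congrArg Finset.card (Finset.ext fun c => ?_)
    rw [Finset.mem_filter, hD x hx c]
    exact and_iff_right (Finset.mem_univ c)
  have hmem : ∀ x ∉ T, 2 ≤ (D x).card → f x ∈ candidates act := fun x hx h =>
    mem_candidates (hlt x) (hactlt _) ((hpop x hx).symm ▸ h)
  have hj : ∀ p q, p ∉ T → p ≠ q → ∀ a ∈ S p q, a ∉ D p → joined act (f p) (f q) = true := by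
    intro p q hp hpq a ha had
    rw [joined_eq_true_iff, (hf p q hpq a).1 ha]
    exact ⟨a.2, by simpa using (hD p hp a).not.2 had⟩
  constructor
  · intro p q hp hq hpq h2p h2q
    have h := checkPoints_pair hc (hmem p hp h2p) (hmem q hq h2q) (hinj.ne hpq)
    rw [hpop p hp, hpop q hq] at h
    have hbit : ∀ a ∈ S p q, (a ∈ D p ↔ a ∈ D q) := by
      intro a ha
      have := mem_common.1 ha
      simp only [D, Finset.mem_symmDiff, S, mem_common, this]
    rcases hcases p q hpq with h0 | ⟨a, ha⟩
    -- Such a code lies beyond the six bits of `act`, so `opposed` is false.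
    · have hs : 6 ≤ slopeCode (f p ^^^ f q) := by
        by_contra! hlt
        have : (⟨_, hlt⟩ : Fin 6) ∈ S p q := (hf p q hpq ⟨_, hlt⟩).2 rfl
        rw [h0] at this
        exact Finset.notMem_empty _ this
      have ho : opposed act (f p) (f q) = false := by
        rw [opposed_eq_testBit]
        exact Nat.testBit_lt_two_pow ((hactlt _).trans_le (Nat.pow_le_pow_right (n := 2) (by norm_num) hs))
      rw [ho] at h
      rw [h0, ← Finset.bot_eq_empty, symmDiff_bot]
      simp only [cond_false] at h
      lia
    · have hmema : a ∈ S p q := by rw [ha]; exact Finset.mem_singleton_self a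
      by_cases had : a ∈ D p
      · have ho : opposed act (f p) (f q) = true := by
          rw [opposed_eq_testBit, (hf p q hpq a).1 hmema]
          exact (hD p hp a).2 had
        have := card_symmDiff_singleton_of_mem ((hbit a hmema).1 had)
        rw [ho] at h
        rw [ha]
        simp only [cond_true] at h
        lia
      · have hjo := hj p q hp hpq a hmema had
        have ho : opposed act (f p) (f q) = false := by
          rw [opposed_eq_testBit, (hf p q hpq a).1 hmema]
          simpa using (hD p hp a).not.2 had
        have := card_symmDiff_singleton_of_notMem (had ∘ (hbit a hmema).2)
        rw [ho, hjo] at h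
        rw [ha]
        simp only [cond_true, cond_false] at h
        lia
  · intro p q r hp hq hr hpq hpr hqr h2p h2q h2r a ha had b hb hbd c hc' hcd
    have h := checkPoints_triple hc (hmem p hp h2p) (hmem q hq h2q) (hmem r hr h2r) (hinj.ne hpq)
      (hj p q hp hpq a ha had) (hj p r hp hpr b hb hbd) (hj q r hq hqr c hc' hcd)
    rw [(hf p q hpq a).1 ha, (hf p r hpr b).1 hb] at h
    exact Fin.ext h

end

/-! ### Three points added to a triangle. -/

section
variable {F : Type*} [Field F] [Fintype F] [DecidableEq F]

theorem card_symmDiff_le {ι : Type*} [DecidableEq ι] (s t : Finset ι) :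
    (s ∆ t).card ≤ s.card + t.card :=
  (Finset.card_le_card (symmDiff_le_sup (a := s) (b := t))).trans (Finset.card_union_le s t)

theorem card_common_le (hF : Fintype.card F = 64) {α : F} (hα : α ^ 6 + α + 1 = 0)
    {x y : F × F} (hxy : x ≠ y) : (common (height α) x y).card ≤ 1 :=
  Finset.card_le_one.2 fun _ hc _ hd => common_subsingleton hF hα hxy hc hd

/-- A sum of nine forces all three connecting lines to exist, to have different classes at `r`, and
each to add a class. The pair bounds then say that any two of the sizes of `D p`, `D q`, `D r` sum
to at most 4, so all three equal 2, which the search over triples excludes. -/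
theorem triangle_sum_of_lt (hF : Fintype.card F = 64) {α : F} (hα : α ^ 6 + α + 1 = 0)
    {u v w : F × F} (huv : u ≠ v) (huw : u ≠ w) (hvw : v ≠ w) {i j k : Fin 6} (hij : i < j)
    (hjk : j < k) (hi : i ∈ common (height α) u v) (hj : j ∈ common (height α) u w)
    (hk : k ∈ common (height α) v w) (p q r : F × F) (hp : p ∉ ({u, v, w} : Finset (F × F)))
    (hq : q ∉ ({u, v, w} : Finset (F × F))) (hr : r ∉ ({u, v, w} : Finset (F × F)))
    (hpq : p ≠ q) (hpr : p ≠ r) (hqr : q ≠ r) :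
    let S := common (height α)
    let D := fun x => S u x ∆ S v x ∆ S w x
    (D p).card + (D q ∆ S p q).card + (D r ∆ S p r ∆ S q r).card ≤ 8 := by
  intro S D
  obtain ⟨C1', C2⟩ := triangle_check hF hα huv huw hvw hij hjk hi hj hk
  change ∀ p q, _ → _ → p ≠ q → 2 ≤ (D p).card → 2 ≤ (D q).card →
      (D p).card + (D q ∆ S p q).card ≤ 5 at C1'
  change ∀ p q r, _ → _ → _ → p ≠ q → p ≠ r → q ≠ r → 2 ≤ (D p).card → 2 ≤ (D q).card →
    2 ≤ (D r).card → ∀ a ∈ S p q, a ∉ D p → ∀ b ∈ S p r, b ∉ D p →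
      ∀ c ∈ S q r, c ∉ D q → a = b at C2
  have hcases : ∀ x y, x ≠ y → S x y = ∅ ∨ ∃ c, S x y = {c} := common_cases hF hα
  have hS1 : ∀ x y, x ≠ y → (S x y).card ≤ 1 := fun x y h => card_common_le hF hα h
  have hstep : ∀ x y, x ≠ y → (D y ∆ S x y).card ≤ (D y).card + 1 := fun x y h =>
    (card_symmDiff_le _ _).trans (by have := hS1 x y h; lia)
  have hD3 : ∀ x, x ∉ ({u, v, w} : Finset (F × F)) → (D x).card ≤ 3 := by
    intro x hx
    simp only [Finset.mem_insert, Finset.mem_singleton, not_or] at hx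
    have h1 := hS1 u x (Ne.symm hx.1)
    have h2 := hS1 v x (Ne.symm hx.2.1)
    have h3 := hS1 w x (Ne.symm hx.2.2)
    have h4 := card_symmDiff_le (S u x) (S v x)
    have h5 := card_symmDiff_le (S u x ∆ S v x) (S w x)
    change (S u x ∆ S v x ∆ S w x).card ≤ 3
    lia
  -- The search covers points with at least two classes; if one point has fewer, 1 + 3 + 1 ≤ 5.
  have C1 : ∀ x y, x ∉ ({u, v, w} : Finset (F × F)) → y ∉ ({u, v, w} : Finset (F × F)) → x ≠ y →
      (D x).card + (D y ∆ S x y).card ≤ 5 := by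
    intro x y hx hy hxy
    by_cases h : 2 ≤ (D x).card ∧ 2 ≤ (D y).card
    · exact C1' x y hx hy hxy h.1 h.2
    · have := hD3 x hx
      have := hD3 y hy
      have := hstep x y hxy
      lia
  have hbit : ∀ x y, ∀ a ∈ S x y, (a ∈ D x ↔ a ∈ D y) := by
    intro x y a ha
    have := mem_common.1 ha
    simp only [D, Finset.mem_symmDiff, S, mem_common, this]
  have hnot : ∀ x y a, S x y = {a} → (D y ∆ S x y).card = (D y).card + 1 → a ∉ D y := by
    intro x y a ha h hm
    have := card_symmDiff_singleton_of_mem hm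
    rw [ha] at h
    lia
  by_contra! hgt
  have p3 := hD3 p hp
  have q3 := hD3 q hq
  have r3 := hD3 r hr
  have c1 := C1 p q hp hq hpq
  have c2 := C1 p r hp hr hpr
  have c3 := C1 q r hq hr hqr
  have s1 := hstep p q hpq
  have s2 := hstep p r hpr
  have s3 := hstep q r hqr
  rcases hcases p r hpr with hb | ⟨b, hb⟩
  · rw [hb, ← Finset.bot_eq_empty, symmDiff_bot] at hgt c2
    lia
  rcases hcases q r hqr with hc | ⟨c, hc⟩
  · rw [hc, ← Finset.bot_eq_empty, symmDiff_bot] at hgt c3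
    lia
  -- Equal classes cancel in the last term, leaving `D r`, of size at most 3.
  by_cases hbc : b = c
  · rw [hb, hc, hbc, symmDiff_symmDiff_cancel_right] at hgt
    lia
  have hw : (D r ∆ S p r ∆ S q r).card + (D r).card = (D r ∆ S p r).card + (D r ∆ S q r).card := by
    rw [hb, hc]
    have hmem : c ∈ D r ∆ {b} ↔ c ∈ D r := by
      simp [Finset.mem_symmDiff, Ne.symm hbc]
    by_cases hm : c ∈ D r
    · have e1 := card_symmDiff_singleton_of_mem hm
      have e2 := card_symmDiff_singleton_of_mem (hmem.2 hm)
      lia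
    · have e1 := card_symmDiff_singleton_of_notMem hm
      have e2 := card_symmDiff_singleton_of_notMem (hm ∘ hmem.1)
      lia
  rcases hcases p q hpq with ha | ⟨a, ha⟩
  · rw [ha, ← Finset.bot_eq_empty, symmDiff_bot] at hgt c1
    lia
  have hna := hnot p q a ha (by lia)
  have hnb := hnot p r b hb (by lia)
  have hnc := hnot q r c hc (by lia)
  have ma : a ∈ S p q := by rw [ha]; exact Finset.mem_singleton_self a
  have mb : b ∈ S p r := by rw [hb]; exact Finset.mem_singleton_self b
  have mc : c ∈ S q r := by rw [hc]; exact Finset.mem_singleton_self c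
  have hab := C2 p q r hp hq hr hpq hpr hqr (by lia) (by lia) (by lia) a ma
    (hna ∘ (hbit p q a ma).1) b mb (hnb ∘ (hbit p r b mb).1) c mc (hnc ∘ (hbit q r c mc).1)
  have mbq : b ∈ S q r :=
    mem_common.2 ((mem_common.1 (hab ▸ ma)).symm.trans (mem_common.1 mb))
  rw [hc, Finset.mem_singleton] at mbq
  exact hbc mbq

/-- Three points outside a triangle whose sides have different slopes: the number of lines that
become even when the points are added one after the other. -/
theorem triangle_sum (hF : Fintype.card F = 64) {α : F} (hα : α ^ 6 + α + 1 = 0)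
    {u v w : F × F} (huv : u ≠ v) (huw : u ≠ w) (hvw : v ≠ w) {i j k : Fin 6} (hij : i ≠ j)
    (hjk : j ≠ k) (hik : i ≠ k) (hi : i ∈ common (height α) u v) (hj : j ∈ common (height α) u w)
    (hk : k ∈ common (height α) v w) (p q r : F × F) (hp : p ∉ ({u, v, w} : Finset (F × F)))
    (hq : q ∉ ({u, v, w} : Finset (F × F))) (hr : r ∉ ({u, v, w} : Finset (F × F)))
    (hpq : p ≠ q) (hpr : p ≠ r) (hqr : q ≠ r) :
    let S := common (height α)
    let D := fun x => S u x ∆ S v x ∆ S w x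
    (D p).card + (D q ∆ S p q).card + (D r ∆ S p r ∆ S q r).card ≤ 8 := by
  wlog h1 : i < j generalizing u v w i j k
  · have := this huw huv hvw.symm hij.symm hik hjk hj hi (by rwa [common_comm])
      (by rwa [Finset.pair_comm]) (by rwa [Finset.pair_comm]) (by rwa [Finset.pair_comm])
      (lt_of_le_of_ne (not_lt.1 h1) hij.symm)
    simpa only [symmDiff_right_comm] using this
  have e1 : ({v, u, w} : Finset (F × F)) = {u, v, w} := Finset.insert_comm _ _ _
  have e2 : ({v, w, u} : Finset (F × F)) = {u, v, w} := by rw [Finset.pair_comm, e1]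
  have hi' : i ∈ common (height α) v u := by rwa [common_comm]
  have hj' : j ∈ common (height α) w u := by rwa [common_comm]
  -- The base vertex becomes the common endpoint of the two sides with the smallest classes.
  rcases lt_or_gt_of_ne hjk with h2 | h2
  · exact triangle_sum_of_lt hF hα huv huw hvw h1 h2 hi hj hk p q r hp hq hr hpq hpr hqr
  rcases lt_or_gt_of_ne hik with h3 | h3
  · have := triangle_sum_of_lt hF hα huv.symm hvw huw h3 h2 hi' hk hj p q r (e1 ▸ hp) (e1 ▸ hq)
      (e1 ▸ hr) hpq hpr hqr
    simpa only [symmDiff_comm (common (height α) v _) (common (height α) u _)] using this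
  · have := triangle_sum_of_lt hF hα hvw huv.symm huw.symm h3 h1 hk hi' hj' p q r (e2 ▸ hp)
      (e2 ▸ hq) (e2 ▸ hr) hpq hpr hqr
    have e : ∀ x, common (height α) v x ∆ common (height α) w x ∆ common (height α) u x =
        common (height α) u x ∆ common (height α) v x ∆ common (height α) w x := fun x => by
      rw [symmDiff_comm, symmDiff_assoc]
    simpa only [e] using this

end

/-! ### Edge counting in Tanner graphs. -/

section Tanner
theorem connections_erase_add {M N : Type*} [DecidableEq N] (H : Matrix M N (ZMod 2)) {A : Finset N} {v : N} (hv : v ∈ A) (c : M) :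
    connections H (A.erase v) c + (if H c v ≠ 0 then 1 else 0) = connections H A c := by
  unfold connections
  rw [Finset.filter_erase]
  split_ifs with h
  · exact Finset.card_erase_add_one (Finset.mem_filter.2 ⟨hv, h⟩)
  · have hm : v ∉ A.filter fun v => H c v ≠ 0 := fun hm => h (Finset.mem_filter.1 hm).2
    rw [Finset.erase_eq_of_notMem hm, add_zero]

variable {M N : Type*} [Fintype M] (H : Matrix M N (ZMod 2))

theorem deg_add_card_odd (A : Finset N) (v : N) :
    deg H A v + ((neighbors H v).filter fun c => Odd (connections H A c)).card =
      (neighbors H v).card := by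
  simp only [deg, ← Nat.not_even_iff_odd]
  exact Finset.card_filter_add_card_filter_not _

/-- Edges not counted by Deg end in odd checks, and each odd check receives at least one. -/
theorem sum_deg_add_emd_le (A : Finset N) :
    ∑ v ∈ A, deg H A v + emd H A ≤ ∑ v ∈ A, (neighbors H v).card := by
  simp only [← deg_add_card_odd H A, Finset.sum_add_distrib]
  gcongr
  have h : ∀ v, ((neighbors H v).filter fun c => Odd (connections H A c)).card =
      ∑ c with Odd (connections H A c), if H c v ≠ 0 then 1 else 0 := by
    intro v
    rw [Finset.sum_boole, neighbors, Finset.filter_comm]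
    simp
  simp only [h]
  rw [Finset.sum_comm, emd, Finset.card_eq_sum_ones]
  refine Finset.sum_le_sum fun c hc => ?_
  rw [Finset.sum_boole, Nat.cast_id]
  exact (Finset.mem_filter.1 hc).2.pos

/-- Removing `v` flips the parity of exactly its neighbors: Deg(v) of them become odd, the others
even. -/
theorem emd_erase_add [DecidableEq N] {A : Finset N} {v : N} (hv : v ∈ A) :
    emd H (A.erase v) + (neighbors H v).card = emd H A + 2 * deg H A v := by
  have hA : ∀ B : Finset N, emd H B =
      ((neighbors H v).filter fun c => Odd (connections H B c)).card +
        (Finset.univ.filter fun c => Odd (connections H B c) ∧ H c v = 0).card := by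
    intro B
    rw [emd, ← Finset.card_filter_add_card_filter_not (fun c => H c v ≠ 0), Finset.filter_filter,
      Finset.filter_filter, neighbors, Finset.filter_filter]
    simp only [not_not, and_comm]
  have h1 : ((neighbors H v).filter fun c => Odd (connections H (A.erase v) c)).card =
      deg H A v := by
    refine congrArg Finset.card (Finset.filter_congr fun c hc => ?_)
    rw [← connections_erase_add H hv c, if_pos (Finset.mem_filter.1 hc).2, Nat.even_add_one,
      Nat.not_even_iff_odd]
  have h2 : (Finset.univ.filter fun c => Odd (connections H (A.erase v) c) ∧ H c v = 0) =
      Finset.univ.filter fun c => Odd (connections H A c) ∧ H c v = 0 := by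
    refine Finset.filter_congr fun c _ => and_congr_left fun hc => ?_
    rw [← connections_erase_add H hv c, if_neg (not_not.2 hc), add_zero]
  have h3 := deg_add_card_odd H A v
  rw [hA, hA A, h1, h2]
  lia

end Tanner

theorem emd_empty {M N : Type*} [Fintype M] (H : Matrix M N (ZMod 2)) : emd H ∅ = 0 := by
  simp [emd, connections]

/-! ### Check matrices given by six classes of lines. -/

section Net
variable {V F : Type*} [DecidableEq F]

/-- The classes of lines for which the line through `x` meets `B` in an odd number of points. -/
def oddClasses (l : Fin 6 → V → F) (B : Finset V) (x : V) : Finset (Fin 6) :=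
  {c | Odd (B.filter fun y => l c y = l c x).card}

theorem oddClasses_empty (l : Fin 6 → V → F) (x : V) : oddClasses l ∅ x = ∅ := by
  simp [oddClasses]

theorem oddClasses_insert [DecidableEq V] (l : Fin 6 → V → F) {B : Finset V} {p : V} (hp : p ∉ B) (x : V) :
    oddClasses l (insert p B) x = oddClasses l B x ∆ common l p x := by
  ext c
  rw [Finset.mem_symmDiff, mem_common, oddClasses, oddClasses, Finset.mem_filter, Finset.mem_filter,
    Finset.filter_insert]
  by_cases h : l c p = l c x
  · rw [if_pos h, Finset.card_insert_of_notMem (fun hm => hp (Finset.mem_filter.1 hm).1),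
      Nat.odd_add_one]
    simp [h]
  · rw [if_neg h]
    simp [h]

variable {H : Matrix (Fin 6 × F) V (ZMod 2)} {l : Fin 6 → V → F}

theorem connections_eq (hH : ∀ c b x, H (c, b) x ≠ 0 ↔ l c x = b) (B : Finset V) (c : Fin 6)
    (b : F) : connections H B (c, b) = (B.filter fun y => l c y = b).card := by
  unfold connections
  simp only [hH]

theorem prodMk_injective {V F : Type*} (l : Fin 6 → V → F) (x : V) :
    Function.Injective fun c => (c, l c x) := fun _ _ h => congrArg Prod.fst h

variable [Fintype F]

theorem neighbors_eq (hH : ∀ c b x, H (c, b) x ≠ 0 ↔ l c x = b) (x : V) :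
    neighbors H x = Finset.univ.image fun c => (c, l c x) := by
  ext ⟨c, b⟩
  simp [neighbors, hH]

theorem card_neighbors (hH : ∀ c b x, H (c, b) x ≠ 0 ↔ l c x = b) (x : V) :
    (neighbors H x).card = 6 := by
  rw [neighbors_eq hH, Finset.card_image_of_injective _ (prodMk_injective l x)]
  rfl

variable [DecidableEq V]

theorem deg_eq (hH : ∀ c b x, H (c, b) x ≠ 0 ↔ l c x = b) {A : Finset V} {x : V} (hx : x ∈ A) :
    deg H A x = (oddClasses l (A.erase x) x).card := by
  rw [deg, neighbors_eq hH, Finset.filter_image,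
    Finset.card_image_of_injective _ (prodMk_injective l x), oddClasses]
  refine congrArg Finset.card (Finset.filter_congr fun c _ => ?_)
  have := connections_erase_add H hx (c, l c x)
  rw [if_pos ((hH _ _ _).2 rfl), connections_eq hH] at this
  rw [← this, Nat.even_add_one, Nat.not_even_iff_odd]

theorem emd_insert (hH : ∀ c b x, H (c, b) x ≠ 0 ↔ l c x = b) {B : Finset V} {x : V}
    (hx : x ∉ B) : emd H (insert x B) + 2 * (oddClasses l B x).card = emd H B + 6 := by
  have h1 := emd_erase_add H (Finset.mem_insert_self x B)
  rw [deg_eq hH (Finset.mem_insert_self x B), Finset.erase_insert hx, card_neighbors hH] at h1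
  exact h1.symm

/-- A point of least Deg lies below the average in the edge count. -/
theorem exists_erase (hH : ∀ c b x, H (c, b) x ≠ 0 ↔ l c x = b) {A : Finset V}
    (hA : A.Nonempty) : ∃ x ∈ A, A.card * (oddClasses l (A.erase x) x).card + emd H A ≤ 6 * A.card ∧
      emd H (A.erase x) + 6 = emd H A + 2 * (oddClasses l (A.erase x) x).card := by
  obtain ⟨x, hx, hmin⟩ := Finset.exists_min_image A (deg H A) hA
  refine ⟨x, hx, ?_, ?_⟩
  · have h1 := sum_deg_add_emd_le H A
    simp only [card_neighbors hH, Finset.sum_const, smul_eq_mul] at h1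
    have h2 := Finset.card_nsmul_le_sum A (deg H A) _ hmin
    rw [smul_eq_mul] at h2
    rw [← deg_eq hH hx]
    lia
  · rw [← deg_eq hH hx, ← emd_erase_add H hx, card_neighbors hH]

end Net

/-! ### Odd checks left by six, seven and eight columns. -/

section Plane
variable {V F : Type*} [Field F] [Fintype F] [DecidableEq F] [DecidableEq V]
  {H : Matrix (Fin 6 × F) V (ZMod 2)} {α : F} {pt : V → F × F}

/-- Six columns leave at least fourteen checks odd. -/
theorem le_emd_of_card_eq_six (hF : Fintype.card F = 64) (hα : α ^ 6 + α + 1 = 0)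
    (hpt : Function.Injective pt) (hH : ∀ c b x, H (c, b) x ≠ 0 ↔ height α c (pt x) = b)
    {A : Finset V} (hA : A.card = 6) : 14 ≤ emd H A := by
  by_contra! hlt
  set l : Fin 6 → V → F := fun c x => height α c (pt x) with hl
  have hHl : ∀ c b x, H (c, b) x ≠ 0 ↔ l c x = b := hH
  obtain ⟨r, hr, r1, r2⟩ := exists_erase hHl (A := A) (Finset.card_pos.1 (by lia))
  have c5 : (A.erase r).card = 5 := by rw [Finset.card_erase_of_mem hr, hA]
  obtain ⟨q, hq, q1, q2⟩ := exists_erase hHl (A := A.erase r) (Finset.card_pos.1 (by lia))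
  have c4 : ((A.erase r).erase q).card = 4 := by rw [Finset.card_erase_of_mem hq, c5]
  obtain ⟨p, hp, p1, p2⟩ := exists_erase hHl (A := (A.erase r).erase q)
    (Finset.card_pos.1 (by lia))
  have c3 : (((A.erase r).erase q).erase p).card = 3 := by rw [Finset.card_erase_of_mem hp, c4]
  set B := ((A.erase r).erase q).erase p with hB
  have hpB : p ∉ B := Finset.notMem_erase _ _
  have e4 : (A.erase r).erase q = insert p B := (Finset.insert_erase hp).symm
  have e5 : A.erase r = insert q (insert p B) := by rw [← e4, Finset.insert_erase hq]
  have hqB : q ∉ insert p B := e4 ▸ Finset.notMem_erase _ _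
  have hrB : r ∉ insert q (insert p B) := e5 ▸ Finset.notMem_erase _ _
  rw [e4, oddClasses_insert l hpB, c5] at q1
  rw [e4, oddClasses_insert l hpB] at q2
  rw [e5, oddClasses_insert l hqB, oddClasses_insert l hpB] at r1 r2
  rw [hA] at r1
  rw [c4] at p1
  obtain ⟨w, v, u, hwv, hwu, hvu, hT⟩ := Finset.card_eq_three.1 c3
  rw [hT] at p1 p2 r1 r2 q1 q2
  have hv0 : v ∉ ({u} : Finset V) := by simpa using hvu
  have hw0 : w ∉ ({v, u} : Finset V) := by simp [hwv, hwu]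
  have hDu : ∀ x, oddClasses l {u} x = common l u x := fun x => by
    rw [← insert_empty_eq, oddClasses_insert l (Finset.notMem_empty u), oddClasses_empty,
      ← Finset.bot_eq_empty, bot_symmDiff]
  have hDT : ∀ x, oddClasses l {w, v, u} x = common l u x ∆ common l v x ∆ common l w x :=
    fun x => by rw [oddClasses_insert l hw0, oddClasses_insert l hv0, hDu]
  have k1 : emd H ({u} : Finset V) = 6 := by
    have := emd_insert hHl (Finset.notMem_empty u)
    rw [oddClasses_empty, emd_empty, insert_empty_eq] at this
    simpa using this
  have k2 := emd_insert hHl hv0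
  have k3 := emd_insert hHl hw0
  rw [hDu, k1] at k2
  rw [oddClasses_insert l hv0, hDu] at k3
  have hS1 : ∀ x y, x ≠ y → (common l x y).card ≤ 1 := fun x y h =>
    card_common_le hF hα (hpt.ne h)
  have s1 := hS1 u v hvu.symm
  have s2 := hS1 u w hwu.symm
  have s3 := hS1 v w hwv.symm
  have s4 := card_symmDiff_le (common l u w) (common l v w)
  simp only [hDT] at r1 r2 q1 q2 p1 p2
  -- The three averaging bounds force e ≤ 12 for the remaining three points, whereas e = 18 - 2m,
  -- where m ≤ 3 counts the lines made even. So m = 3: every two points are joined, and nothing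
  -- cancels.
  obtain ⟨i, hi⟩ := Finset.card_eq_one.1 (show (common l u v).card = 1 by lia)
  obtain ⟨j, hj⟩ := Finset.card_eq_one.1 (show (common l u w).card = 1 by lia)
  obtain ⟨k, hk⟩ := Finset.card_eq_one.1 (show (common l v w).card = 1 by lia)
  have mi : i ∈ common l u v := by rw [hi]; exact Finset.mem_singleton_self i
  have mj : j ∈ common l u w := by rw [hj]; exact Finset.mem_singleton_self j
  have mk : k ∈ common l v w := by rw [hk]; exact Finset.mem_singleton_self k
  have hjk : j ≠ k := by
    rintro rfl
    rw [hj, hk, symmDiff_self, Finset.bot_eq_empty, Finset.card_empty] at k3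
    lia
  have hij : i ≠ j := by
    rintro rfl
    have : i ∈ common l v w :=
      mem_common.2 ((mem_common.1 mi).symm.trans (mem_common.1 mj))
    rw [hk, Finset.mem_singleton] at this
    exact hjk this
  have hik : i ≠ k := by
    rintro rfl
    have : i ∈ common l u w :=
      mem_common.2 ((mem_common.1 mi).trans (mem_common.1 mk))
    rw [hj, Finset.mem_singleton] at this
    exact hij this
  rw [hT] at hpB hqB hrB
  simp only [Finset.mem_insert, Finset.mem_singleton, not_or] at hpB hqB hrB
  have hout : ∀ x, x ≠ w ∧ x ≠ v ∧ x ≠ u → pt x ∉ ({pt u, pt v, pt w} : Finset (F × F)) := by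
    rintro x ⟨h1, h2, h3⟩
    simp [hpt.eq_iff, h1, h2, h3]
  -- With at most eight lines made even, e ≥ 12 + 18 - 16 = 14.
  have := triangle_sum hF hα (hpt.ne hvu.symm) (hpt.ne hwu.symm) (hpt.ne hwv.symm) hij hjk hik
    mi mj mk (pt p) (pt q) (pt r) (hout p hpB) (hout q hqB.2) (hout r hrB.2.2)
    (hpt.ne (Ne.symm hqB.1)) (hpt.ne (Ne.symm hrB.2.1)) (hpt.ne (Ne.symm hrB.1))
  change (common l u p ∆ common l v p ∆ common l w p).card +
    (common l u q ∆ common l v q ∆ common l w q ∆ common l p q).card +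
    (common l u r ∆ common l v r ∆ common l w r ∆ common l p r ∆ common l q r).card ≤ 8 at this
  lia

/-- The least Deg is at least (20 - e) / 2. If e ≤ 11 it is at least 5, so 35 + e ≤ 42 and e ≤ 7;
then it is at least 7, more than the average allows. -/
theorem le_emd_of_card_eq_seven (hF : Fintype.card F = 64) (hα : α ^ 6 + α + 1 = 0)
    (hpt : Function.Injective pt) (hH : ∀ c b x, H (c, b) x ≠ 0 ↔ height α c (pt x) = b)
    {A : Finset V} (hA : A.card = 7) : 12 ≤ emd H A := by
  obtain ⟨x, hx, h1, h2⟩ := exists_erase (l := fun c x => height α c (pt x)) hH (A := A)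
    (Finset.card_pos.1 (by lia))
  have := le_emd_of_card_eq_six hF hα hpt hH (A := A.erase x)
    (by rw [Finset.card_erase_of_mem hx, hA])
  rw [hA] at h1
  lia

/-- Eight columns leave at least eight checks odd, and if they leave exactly eight odd, then each
of them has five even neighbors. -/
theorem emd_of_card_eq_eight (hF : Fintype.card F = 64) (hα : α ^ 6 + α + 1 = 0)
    (hpt : Function.Injective pt) (hH : ∀ c b x, H (c, b) x ≠ 0 ↔ height α c (pt x) = b)
    {A : Finset V} (hA : A.card = 8) :
    8 ≤ emd H A ∧ (emd H A = 8 → ∀ x ∈ A, deg H A x = 5) := by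
  have hn := card_neighbors (l := fun c x => height α c (pt x)) hH
  have hdeg : ∀ x ∈ A, 18 ≤ emd H A + 2 * deg H A x := by
    intro x hx
    have h1 := emd_erase_add H hx
    have h2 := le_emd_of_card_eq_seven hF hα hpt hH (A := A.erase x)
      (by rw [Finset.card_erase_of_mem hx, hA])
    rw [hn] at h1
    lia
  have hsum := sum_deg_add_emd_le H A
  simp only [hn, Finset.sum_const, hA, smul_eq_mul] at hsum
  -- With `hsum` this reads 8(18 - e) ≤ 2(48 - e), that is e ≥ 8.
  have hmul : 8 * (18 - emd H A) ≤ 2 * ∑ x ∈ A, deg H A x := by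
    rw [Finset.mul_sum, ← hA, ← smul_eq_mul]
    exact Finset.card_nsmul_le_sum A _ _ fun x hx => by have := hdeg x hx; lia
  refine ⟨by lia, fun h8 => ?_⟩
  have h5 : ∀ x ∈ A, 5 ≤ deg H A x := fun x hx => by have := hdeg x hx; lia
  have heq : ∑ x ∈ A, 5 = ∑ x ∈ A, deg H A x := by
    refine le_antisymm (Finset.sum_le_sum h5) ?_
    rw [Finset.sum_const, hA, smul_eq_mul]
    lia
  exact fun x hx => ((Finset.sum_eq_sum_iff_of_le h5).1 heq x hx).symm

end Plane

/-! ### The Reed–Solomon words, and columns as points. -/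

section
variable {F : Type*} [Field F]

theorem rsGen_eq (α : F) : rsGen α = ∏ i ∈ Finset.range 30, (X - C (α ^ (i + 1))) := by
  rw [rsGen, Finset.range_eq_Ico, Finset.prod_Ico_add' (fun i => X - C (α ^ i)) 0 30 1]
  rfl

/-- Substituting `αX` moves the roots `α, …, α³⁰` to `1, …, α²⁹`; the extra factors complete both
sides to the product over `1, …, α³⁰`. Comparing coefficients gives a two-term recursion. -/
theorem rsGen_comp (α : F) :
    (rsGen α).comp (C α * X) * (X - C (α ^ 30)) = C (α ^ 30) * rsGen α * (X - C 1) := by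
  have h1 : (rsGen α).comp (C α * X) = C (α ^ 30) * ∏ i ∈ Finset.range 30, (X - C (α ^ i)) := by
    have : C (α ^ 30) = ∏ _i ∈ Finset.range 30, C α := by
      rw [Finset.prod_const, Finset.card_range, C_pow]
    rw [rsGen_eq, prod_comp, this, ← Finset.prod_mul_distrib]
    refine Finset.prod_congr rfl fun i _ => ?_
    rw [sub_comp, X_comp, C_comp, pow_succ', C_mul, mul_sub]
  have h2 := Finset.prod_range_succ (fun i => X - C (α ^ i)) 30
  rw [Finset.prod_range_succ', pow_zero, ← rsGen_eq] at h2
  rw [h1, mul_assoc, ← h2, mul_assoc]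

theorem rsGen_coeff_succ (α : F) (k : ℕ) :
    (rsGen α).coeff k * (α ^ k - α ^ 30) =
      α ^ 30 * (rsGen α).coeff (k + 1) * (α ^ (k + 1) - 1) := by
  have h := congrArg (fun p => coeff p (k + 1)) (rsGen_comp α)
  simp only [coeff_mul_X_sub_C, comp_C_mul_X_coeff, coeff_C_mul] at h
  linear_combination h

theorem rsGen_natDegree (α : F) : (rsGen α).natDegree = 30 := by
  rw [rsGen, natDegree_prod_of_monic _ _ fun i _ => monic_X_sub_C _,
    Finset.sum_congr rfl fun i _ => natDegree_X_sub_C (α ^ i)]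
  simp

theorem rsGen_coeff_thirty (α : F) : (rsGen α).coeff 30 = 1 := by
  have : (rsGen α).Monic := monic_prod_of_monic _ _ fun i _ => monic_X_sub_C _
  have h := this.coeff_natDegree
  rwa [rsGen_natDegree] at h

variable [Fintype F]

theorem pow_inj_of_lt (hF : Fintype.card F = 64) {α : F} (hα : α ^ 6 + α + 1 = 0) {m n : ℕ}
    (hm : m < 63) (hn : n < 63) (h : α ^ m = α ^ n) : m = n :=
  pow_injOn_Iio_orderOf (by simpa [orderOf_root hF hα] using hm)
    (by simpa [orderOf_root hF hα] using hn) h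

theorem rsGen_coeff_ne_zero (hF : Fintype.card F = 64) {α : F} (hα : α ^ 6 + α + 1 = 0) {k : ℕ}
    (hk : k ≤ 30) : (rsGen α).coeff k ≠ 0 := by
  have h0 : α ≠ 0 := by rintro rfl; simp at hα
  induction hk using Nat.decreasingInduction with
  | self => rw [rsGen_coeff_thirty]; exact one_ne_zero
  | of_succ k hk ih =>
    intro h
    have h1 := rsGen_coeff_succ α k
    rw [h, zero_mul] at h1
    refine mul_ne_zero (mul_ne_zero (pow_ne_zero 30 h0) ih) (sub_ne_zero.2 fun h2 => ?_) h1.symm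
    have := pow_inj_of_lt hF hα (m := k + 1) (n := 0) (by lia) (by lia) (by rw [h2, pow_zero])
    lia

/-- Up to a common scalar, the symbols of the two words are affine functions of `α ^ j`. -/
theorem exists_word_eq (hF : Fintype.card F = 64) {α : F} (hα : α ^ 6 + α + 1 = 0) (j : Fin 32) :
    ∃ s : F, s ≠ 0 ∧ cosetWord α j = s * (α ^ (j : ℕ) + 1) ∧
      baseWord α j = s * (α ^ (j : ℕ) * (1 + α) + (1 + α ^ 32)) := by
  have := charTwo_of_card hF
  have h2 : (2 : F) = 0 := CharTwo.two_eq_zero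
  have h0 : α ≠ 0 := by rintro rfl; simp at hα
  obtain ⟨j, hj⟩ := j
  cases j with
  | zero =>
    have hne : α + α ^ 32 ≠ 0 := fun h => by
      have := pow_inj_of_lt hF hα (m := 1) (n := 32) (by lia) (by lia)
        (by rw [pow_one]; exact CharTwo.add_eq_zero.1 h)
      lia
    -- At `j = 0` the word `cosetWord` vanishes, so the scalar is read off from `baseWord`; for `j >
    -- 0` it is read off from `cosetWord`.
    refine ⟨α ^ 32 * (rsGen α).coeff 0 / (α + α ^ 32), div_ne_zero (mul_ne_zero (pow_ne_zero _ h0)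
      (rsGen_coeff_ne_zero hF hα (by lia))) hne, ?_, ?_⟩
    · simp [cosetWord, CharTwo.add_self_eq_zero]
    · rw [div_mul_eq_mul_div, eq_div_iff hne]
      simp only [baseWord, mul_coeff_zero, coeff_sub, coeff_X_zero, coeff_C_zero]
      linear_combination -(α ^ 32 * (rsGen α).coeff 0 * (1 + α + α ^ 32)) * h2
  | succ m =>
    have hne : α ^ (m + 1) + 1 ≠ 0 := fun h => by
      have := pow_inj_of_lt hF hα (m := m + 1) (n := 0) (by lia) (by lia)
        (by rw [pow_zero]; exact CharTwo.add_eq_zero.1 h)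
      lia
    refine ⟨(rsGen α).coeff m / (α ^ (m + 1) + 1),
      div_ne_zero (rsGen_coeff_ne_zero hF hα (by lia)) hne, ?_, ?_⟩
    · rw [div_mul_cancel₀ _ hne]
      simp [cosetWord, coeff_X_mul]
    · rw [div_mul_eq_mul_div, eq_div_iff hne]
      have h := rsGen_coeff_succ α m
      have hb : baseWord α ⟨m + 1, hj⟩ =
          (rsGen α).coeff m - (rsGen α).coeff (m + 1) * α ^ 32 := by
        rw [baseWord, mul_comm, coeff_mul_X_sub_C]
      rw [hb]
      linear_combination α ^ 2 * h -
        ((rsGen α).coeff m * α ^ (m + 2) + (rsGen α).coeff (m + 1) * α ^ 32) * h2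

/-- By Frobenius `1 + α³² = (1 + α)³² = α¹⁹² = α³`, so the sum is `α ^ (k + 6) + α ^ 3`. -/
theorem bracket_ne_zero (hF : Fintype.card F = 64) {α : F} (hα : α ^ 6 + α + 1 = 0) {k : ℕ}
    (hk : k < 32) : α ^ k * (1 + α) + (1 + α ^ 32) ≠ 0 := by
  have := charTwo_of_card hF
  have h6 : 1 + α = α ^ 6 := by
    rw [← CharTwo.add_eq_zero]; linear_combination hα
  have h0 : α ≠ 0 := by rintro rfl; simp at hα
  have h63 : α ^ 63 = 1 := orderOf_root hF hα ▸ pow_orderOf_eq_one α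
  have h32 : 1 + α ^ 32 = α ^ 3 := by
    have := add_pow_char_pow (R := F) (p := 2) (n := 5) (1 : F) α
    norm_num at this
    rw [← this, h6, ← pow_mul, show 6 * 32 = 63 * 3 + 3 by rfl, pow_add, pow_mul, h63, one_pow,
      one_mul]
  rw [h6, h32, ← pow_add]
  intro h
  have := pow_inj_of_lt hF hα (by lia) (by lia) (CharTwo.add_eq_zero.1 h)
  lia

theorem baseWord_ne_zero (hF : Fintype.card F = 64) {α : F} (hα : α ^ 6 + α + 1 = 0)
    (j : Fin 32) : baseWord α j ≠ 0 := by
  obtain ⟨s, hs, -, h⟩ := exists_word_eq hF hα j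
  rw [h]
  exact mul_ne_zero hs (bracket_ne_zero hF hα j.2)

/-- The ratio is a Möbius function of `α ^ j` with determinant `α + α³² ≠ 0`. -/
theorem cosetWord_div_baseWord_injective (hF : Fintype.card F = 64) {α : F}
    (hα : α ^ 6 + α + 1 = 0) : Function.Injective fun j => cosetWord α j / baseWord α j := by
  intro j k h
  have := charTwo_of_card hF
  have hb := baseWord_ne_zero hF hα
  simp only at h
  rw [div_eq_div_iff (hb j) (hb k)] at h
  obtain ⟨s, hs, h1, h2⟩ := exists_word_eq hF hα j
  obtain ⟨t, ht, h3, h4⟩ := exists_word_eq hF hα k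
  rw [h1, h2, h3, h4] at h
  have hne : α - α ^ 32 ≠ 0 := fun h => by
    have := pow_inj_of_lt hF hα (m := 1) (n := 32) (by lia) (by lia)
      (by rw [pow_one]; exact sub_eq_zero.1 h)
    lia
  have : s * t * (α - α ^ 32) * (α ^ (j : ℕ) - α ^ (k : ℕ)) = 0 := by
    linear_combination -h
  have := (mul_eq_zero.1 this).resolve_left (mul_ne_zero (mul_ne_zero hs ht) hne)
  exact Fin.ext (pow_inj_of_lt hF hα (by lia) (by lia) (sub_eq_zero.1 this))

/-- The point of the plane that represents a column of the parity-check matrix. -/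
noncomputable def columnPoint (α : F) (s : Fin 32 × F) : F × F :=
  (cosetWord α s.1 / baseWord α s.1, s.2 / baseWord α s.1)

theorem columnPoint_injective (hF : Fintype.card F = 64) {α : F} (hα : α ^ 6 + α + 1 = 0) :
    Function.Injective (columnPoint α) := by
  rintro ⟨j, x⟩ ⟨k, y⟩ h
  obtain ⟨h1, h2⟩ := Prod.ext_iff.1 h
  obtain rfl : j = k := cosetWord_div_baseWord_injective hF hα h1
  exact Prod.ext rfl ((div_left_inj' (baseWord_ne_zero hF hα j)).1 h2)

variable [DecidableEq F]

theorem parityCheck_ne_zero_iff (hF : Fintype.card F = 64) {α : F} (hα : α ^ 6 + α + 1 = 0)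
    (c : Fin 6) (b : F) (s : Fin 32 × F) :
    parityCheck α (c, b) s ≠ 0 ↔ height α c (columnPoint α s) = b := by
  have := charTwo_of_card hF
  have h2 : (2 : F) = 0 := CharTwo.two_eq_zero
  have hb := baseWord_ne_zero hF hα s.1
  simp only [parityCheck, Matrix.of_apply, ne_eq, ite_eq_right_iff, one_ne_zero, imp_false, not_not,
    height, columnPoint]
  rw [mul_div_assoc', ← add_div, div_eq_iff hb]
  constructor <;> intro h
  · linear_combination -h + cosetMul α c * cosetWord α s.1 * h2
  · linear_combination -h + cosetMul α c * cosetWord α s.1 * h2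

end

/-! ### Sets without odd checks, and codewords. -/

theorem even_card_of_emd_eq_zero {V F : Type*} [Fintype F] [DecidableEq F]
    {H : Matrix (Fin 6 × F) V (ZMod 2)} {l : Fin 6 → V → F}
    (hH : ∀ c b x, H (c, b) x ≠ 0 ↔ l c x = b) {A : Finset V} (hA : emd H A = 0) :
    Even A.card := by
  have h : ∀ c, Even (connections H A c) := fun c => by
    have := Finset.filter_eq_empty_iff.1 (Finset.card_eq_zero.1 hA) (Finset.mem_univ c)
    rwa [Nat.not_odd_iff_even] at this
  -- The lines of one class partition the points; class 0 is an arbitrary choice.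
  rw [Finset.card_eq_sum_card_fiberwise (f := l 0) (t := Finset.univ) (fun _ _ => by simp)]
  refine Finset.even_sum _ fun b _ => ?_
  rw [← connections_eq hH]
  exact h _

/-- Each of the six lines through a point carries a further point, and no point serves two lines. -/
theorem seven_le_card_of_emd_eq_zero {V F : Type*} [Fintype F] [Field F] [DecidableEq F]
    [DecidableEq V] {H : Matrix (Fin 6 × F) V (ZMod 2)} {α : F} {pt : V → F × F}
    (hF : Fintype.card F = 64) (hα : α ^ 6 + α + 1 = 0)
    (hpt : Function.Injective pt) (hH : ∀ c b x, H (c, b) x ≠ 0 ↔ height α c (pt x) = b)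
    {A : Finset V} (hne : A.Nonempty) (hA : emd H A = 0) : 7 ≤ A.card := by
  obtain ⟨x, hx⟩ := hne
  set l : Fin 6 → V → F := fun c x => height α c (pt x) with hl
  have hHl : ∀ c b x, H (c, b) x ≠ 0 ↔ l c x = b := hH
  have h1 := deg_add_card_odd H A x
  have h2 : ((neighbors H x).filter fun c => Odd (connections H A c)).card = 0 :=
    Nat.le_zero.1 (hA ▸ Finset.card_le_card (Finset.filter_subset_filter _ (Finset.subset_univ _)))
  rw [h2, card_neighbors hHl, deg_eq hHl hx] at h1
  have h3 : ∀ B : Finset V, x ∉ B → (oddClasses l B x).card ≤ B.card := by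
    intro B
    induction B using Finset.induction_on with
    | empty => simp [oddClasses_empty]
    | insert y B hy ih =>
      intro hxB
      rw [Finset.mem_insert, not_or] at hxB
      rw [oddClasses_insert l hy, Finset.card_insert_of_notMem hy]
      have e1 := card_symmDiff_le (oddClasses l B x) (common l y x)
      have e2 : (common l y x).card ≤ 1 := card_common_le hF hα (hpt.ne (Ne.symm hxB.1))
      have := ih hxB.2
      lia
  have := h3 _ (Finset.notMem_erase x A)
  rw [Finset.card_erase_of_mem hx] at this
  lia

theorem emd_support_eq_zero {M N : Type*} [Fintype M] [Fintype N] {H : Matrix M N (ZMod 2)}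
    {z : N → ZMod 2} (hz : z ∈ code H) : emd H (Finset.univ.filter fun v => z v ≠ 0) = 0 := by
  rw [emd, Finset.card_eq_zero, Finset.filter_eq_empty_iff]
  intro c _
  have h : ∑ v, H c v * z v = 0 := congrFun (LinearMap.mem_ker.1 hz) c
  rw [Nat.not_odd_iff_even, ← ZMod.natCast_eq_zero_iff_even, connections,
    Finset.filter_filter, ← Finset.sum_boole]
  refine (Finset.sum_congr rfl fun v _ => ?_).trans h
  generalize H c v = a
  generalize z v = b
  revert a b
  decide

end LDPC

theorem mainTheorem2 {F : Type*} [Field F] [Fintype F] [DecidableEq F]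
    (hF : Fintype.card F = 64) (α : F) (hα : α ^ 6 + α + 1 = 0) :
    (∀ b : ℕ, b < 8 → ¬ ∃ A : Finset (Fin 32 × F),
      LDPC.IsAbsorptionSetOf (LDPC.parityCheck α) 8 b A) ∧
    (∀ A : Finset (Fin 32 × F), LDPC.IsAbsorptionSetOf (LDPC.parityCheck α) 8 8 A →
      (∀ v ∈ A, LDPC.deg (LDPC.parityCheck α) A v ≠ 6) ∧
      LDPC.connectivityClass (LDPC.parityCheck α) A = {5, 5, 5, 5, 5, 5, 5, 5}) ∧
    10 ≤ LDPC.minDist (LDPC.code (LDPC.parityCheck α)) ∧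
    ¬ ∃ A : Finset (Fin 32 × F), LDPC.IsAbsorptionSetOf (LDPC.parityCheck α) 9 0 A := by
  have hpt := LDPC.columnPoint_injective hF hα
  have hH := LDPC.parityCheck_ne_zero_iff hF hα
  have h8 : ∀ A : Finset (Fin 32 × F), A.card = 8 → _ := fun A hA =>
    LDPC.emd_of_card_eq_eight hF hα hpt hH hA
  have heven : ∀ A : Finset (Fin 32 × F), LDPC.emd (LDPC.parityCheck α) A = 0 → Even A.card :=
    fun A => LDPC.even_card_of_emd_eq_zero
      (l := fun c s => LDPC.height α c (LDPC.columnPoint α s)) hH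
  refine ⟨?_, ?_, ?_, ?_⟩
  · rintro b hb ⟨A, -, hA, rfl⟩
    exact absurd (h8 A hA).1 (not_le.2 hb)
  · rintro A ⟨-, hA, he⟩
    have h5 := (h8 A hA).2 he
    refine ⟨fun v hv => by rw [h5 v hv]; decide, ?_⟩
    rw [LDPC.connectivityClass, Multiset.map_congr rfl h5, Multiset.map_const', Finset.card_val, hA]
    rfl
  · have hmin : ∀ z ∈ LDPC.code (LDPC.parityCheck α), z ≠ 0 →
        10 ≤ (Finset.univ.filter fun s => z s ≠ 0).card := by
      intro z hz hz0
      have he := LDPC.emd_support_eq_zero hz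
      have h7 := LDPC.seven_le_card_of_emd_eq_zero hF hα hpt hH (by
        obtain ⟨s, hs⟩ := Function.ne_iff.1 hz0
        exact ⟨s, by simpa using hs⟩) he
      obtain ⟨m, hm⟩ := heven _ he
      have := h8 (Finset.univ.filter fun s => z s ≠ 0)
      by_contra! hlt
      have := (this (by lia)).1
      lia
    -- A nonzero codeword exists because 384 < 2048. It is needed since `sInf ∅ = 0`.
    obtain ⟨z, hz, hz0⟩ := (Submodule.ne_bot_iff _).1
      (LinearMap.ker_ne_bot_of_finrank_lt (f := (LDPC.parityCheck α).mulVecLin)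
        (by simp [hF]))
    refine le_csInf ⟨_, z, hz, 0, Submodule.zero_mem _, hz0, rfl⟩ ?_
    rintro d ⟨x, hx, y, hy, hxy, rfl⟩
    have := hmin (x - y) (Submodule.sub_mem _ hx hy) (sub_ne_zero.2 hxy)
    rw [hammingDist]
    simpa only [Pi.sub_apply, sub_ne_zero] using this
  · rintro ⟨A, -, hA, he⟩
    have := heven A he
    rw [hA] at this
    revert this
    decide
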